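/- Let $k\ge 1$ and let $M$ be a real $n$-dimensional $C^\infty$ manifold. Let $T^kM$ be the bundle of $k$-jets at $0$ of smooth curves in $M$, with the coordinates $(x^i,y^{(1)i},\dots,y^{(k)i})$, $y^{(\alpha)i}=\frac1{\alpha!}\frac{d^\alpha x^i}{dt^\alpha}$, induced by each local chart of $M$ (write $y^{(0)}=x$), and let $\widetilde{T^kM}=\{y^{(1)}\neq 0\}\subset T^kM$. Repeated indices are summed, and put $$\Gamma=\sum_{\alpha=1}^{k}\alpha\,y^{(\alpha)i}\frac{\partial}{\partial y^{(\alpha-1)i}},\qquad \overset{k}{\Gamma}=\sum_{\alpha=1}^{k}\alpha\,y^{(\alpha)i}\frac{\partial}{\partial y^{(\alpha)i}} .$$ Let $J$ be the $k$-tangent structure: $J\frac{\partial}{\partial y^{(\alpha)i}}=\frac{\partial}{\partial y^{(\alpha+1)i}}$ for $0\le\alpha<k$ and $J\frac{\partial}{\partial y^{(k)i}}=0$. A $k$-semispray is a smooth vector field $S$ on $\widetilde{T^kM}$ with $JS=\overset{k}{\Gamma}$. In each chart $S=\Gamma-(k+1)G^i\frac{\partial}{\partial y^{(k)i}}$, and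 $G^i$ are its coefficients. It is a $k$-spray if $G^i(x,\lambda y^{(1)},\dots,\lambda^ky^{(k)})=\lambda^{k+1}G^i(x,y^{(1)},\dots,y^{(k)})$ for all $\lambda>0$. A nonlinear connection is a smooth distribution on $\widetilde{T^kM}$ supplementary to the vertical distribution $\ker d\pi^k$. Its dual coefficients in a chart are the functions $\underset{(1)}{M}{}^i_j,\dots,\underset{(k)}{M}{}^i_j$ such that it is the common kernel of the forms $\delta y^{(\alpha)i}=dy^{(\alpha)i}+\underset{(1)}{M}{}^i_j\,dy^{(\alpha-1)j}+\cdots+\underset{(\alpha)}{M}{}^i_j\,dx^j$, $1\le\alpha\le k$. A $k$-semispray $S$ with coefficients $G^i$ determines two nonlinear connections: Miron's connection, with dual coefficients $$\underset{(1)}{M}{}^i_j=\frac{\partial G^i}{\partial y^{(k)j}},\qquad \underset{(a)}{M}{}^i_j=\frac1a\Big(S\underset{(a-1)}{M}{}^i_j+\underset{(1)}{M}{}^i_m\underset{(a-1)}{M}{}^m_j\Big)\quad(2\le a\le k),$$ and Bucătaru's connection, with dual coefficients $\underset{(a)}{M}{}^{*i}_j=\frac{\partial G^i}{\partial y^{(k+1-a)j}}$,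 $1\le a\le k$. Starting from a $k$-semispray $\overset{1}{S}$, define $k$-semisprays $\overset{m}{S}$, $m\ge1$, by $\overset{m+1}{G}{}^i=\frac1{k+1}\overset{k}{\Gamma}\,\overset{m}{G}{}^i$, and let $\overset{m}{N}$ and $\overset{m}{N}{}^*$ be Miron's and Bucătaru's connections of $\overset{m}{S}$. A Finsler space of order $k$ is a pair $(M,F)$, $F:T^kM\to\mathbb R$, such that: $F$ is $C^\infty$ on $\widetilde{T^kM}$ and continuous at the points of the null section (the jets of constant curves); $F>0$ on $\widetilde{T^kM}$; $F(x,\lambda y^{(1)},\dots,\lambda^ky^{(k)})=\lambda^kF(x,y^{(1)},\dots,y^{(k)})$ for all $\lambda>0$; and the matrix $g_{ij}=\frac12\frac{\partial^2F^2}{\partial y^{(k)i}\partial y^{(k)j}}$ is positive definite on $\widetilde{T^kM}$. Its canonical $k$-semispray $S_{F^2}$ is the one with coefficients $$(k+1)G^i=\frac12 g^{ij}\Big\{\Gamma\Big(\frac{\partial F^2}{\partial y^{(k)j}}\Big)-\frac{\partial F^2}{\partial y^{(k-1)j}}\Big\},$$ and its Cartan nonlinear connection is the one with dual coefficients $$\underset{(1)}{M}{}^i_j=\frac1{2(k+1)}\frac{\partial}{\partial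 y^{(k)j}}\Big\{g^{im}\Big[\Gamma\Big(\frac{\partial F^2}{\partial y^{(k)m}}\Big)-\frac{\partial F^2}{\partial y^{(k-1)m}}\Big]\Big\},\qquad \underset{(a)}{M}{}^i_j=\frac1a\Big(S_{F^2}\underset{(a-1)}{M}{}^i_j+\underset{(1)}{M}{}^i_m\underset{(a-1)}{M}{}^m_j\Big)\quad(2\le a\le k).$$ Theorem. Let $(M,F)$ be a Finsler space of order $k$. Then the formulas above define a unique $k$-semispray $S_{F^2}$ on $\widetilde{T^kM}$; it is a $k$-spray; the sequences $(\overset{m}{S})$, $(\overset{m}{N})$, $(\overset{m}{N}{}^*)$ starting from $\overset{1}{S}=S_{F^2}$ exist; and a) the sequence $(\overset{m}{S})_{m\ge1}$ is constant, equal to $S_{F^2}$; b) the sequences $(\overset{m}{N})_{m\ge1}$ and $(\overset{m}{N}{}^*)_{m\ge1}$ are constant, $\overset{1}{N}$ is the Cartan nonlinear connection of $(M,F)$, and $\overset{1}{N}{}^*$ is Bucătaru's connection for $L=F^2$, i.e. the one with dual coefficients $\frac{\partial G^i}{\partial y^{(k+1-a)j}}$, $1\le a\le k$, where $G^i$ are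 the coefficients of $S_{F^2}$. -/

import Mathlib

open scoped Manifold ContDiff

noncomputable section

namespace HigherTangent

/-! ### The bundle of accelerations `T^k M` as a manifold of `k`-jets of curves -/

/-- The coordinate space of `T^k M`: a point `p` has components `p 0 = x`, `p α = y^(α)`
(`1 ≤ α ≤ k`), each in `ℝⁿ`. -/
abbrev JetModel (n k : ℕ) : Type := Fin (k + 1) → EuclideanSpace ℝ (Fin n)

/-- Charts of the maximal smooth atlas of `M`: the local charts of `M`. -/
abbrev LocalCharts (n : ℕ) (M : Type*) [TopologicalSpace M]
    [ChartedSpace (EuclideanSpace ℝ (Fin n)) M] :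
    Set (OpenPartialHomeomorph M (EuclideanSpace ℝ (Fin n))) :=
  IsManifold.maximalAtlas (𝓡 n) ∞ M

/-- Curves in `M` that are smooth at time `0`. -/
abbrev SmoothCurve (n : ℕ) (M : Type*) [TopologicalSpace M]
    [ChartedSpace (EuclideanSpace ℝ (Fin n)) M] : Type _ :=
  {γ : ℝ → M // ContMDiffAt 𝓘(ℝ, ℝ) (𝓡 n) ∞ γ 0}

/-- The coordinates `y^(α) = (1/α!) d^α x/dt^α (0)`, `0 ≤ α ≤ k`, of a curve in a chart. -/
def curveCoord {n : ℕ} (k : ℕ) {M : Type*} [TopologicalSpace M]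
    (φ : OpenPartialHomeomorph M (EuclideanSpace ℝ (Fin n))) (γ : ℝ → M) : JetModel n k :=
  fun α => (Nat.factorial α : ℝ)⁻¹ • iteratedDeriv (α : ℕ) (φ ∘ γ) 0

/-- Two curves have the same `k`-jet at `0` if they pass through the same point and have the same
derivatives up to order `k` in every chart around it. -/
def jetSetoid (n k : ℕ) (M : Type*) [TopologicalSpace M]
    [ChartedSpace (EuclideanSpace ℝ (Fin n)) M] : Setoid (SmoothCurve n M) where
  r γ γ' := γ.1 0 = γ'.1 0 ∧ ∀ φ ∈ LocalCharts n M, γ.1 0 ∈ φ.source →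
    curveCoord k φ γ.1 = curveCoord k φ γ'.1
  iseqv :=
    { refl := fun _ => ⟨rfl, fun _ _ _ => rfl⟩
      symm := fun h => ⟨h.1.symm, fun φ hφ hs => (h.2 φ hφ (h.1 ▸ hs)).symm⟩
      trans := fun h h' => ⟨h.1.trans h'.1, fun φ hφ hs =>
        (h.2 φ hφ hs).trans (h'.2 φ hφ (h.1 ▸ hs))⟩ }

/-- The bundle of accelerations of order `k` (the `k`-osculator bundle) `T^k M`. -/
def AccBundle (n k : ℕ) (M : Type*) [TopologicalSpace M]
    [ChartedSpace (EuclideanSpace ℝ (Fin n)) M] : Type _ :=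
  Quotient (jetSetoid n k M)

section Bundle

variable {n k : ℕ} {M : Type*} [TopologicalSpace M] [ChartedSpace (EuclideanSpace ℝ (Fin n)) M]

/-- The `k`-jet at `0` of a curve. -/
def AccBundle.mk (k : ℕ) (γ : SmoothCurve n M) : AccBundle n k M :=
  Quotient.mk (jetSetoid n k M) γ

/-- The projection `π^k : T^k M → M`. -/
def AccBundle.proj : AccBundle n k M → M :=
  Quotient.lift (fun γ : SmoothCurve n M => γ.1 0) (fun _ _ h => h.1)

/-- The null section `M → T^k M`: jets of constant curves. -/
def AccBundle.null (k : ℕ) (x : M) : AccBundle n k M :=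
  AccBundle.mk k ⟨fun _ => x, contMDiffAt_const⟩

open Classical in
/-- The induced coordinates `(x, y^(1), …, y^(k))` on `T^k M` (extended by `0` outside the
domain `(π^k)⁻¹(U)` of the chart). -/
def jetCoord (k : ℕ) (φ : OpenPartialHomeomorph M (EuclideanSpace ℝ (Fin n))) :
    AccBundle n k M → JetModel n k :=
  Quotient.lift
    (fun γ : SmoothCurve n M =>
      if φ ∈ LocalCharts n M ∧ γ.1 0 ∈ φ.source then curveCoord k φ γ.1 else 0)
    (fun γ γ' h => by
      have h0 : γ.1 0 = γ'.1 0 := h.1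
      by_cases hc : φ ∈ LocalCharts n M ∧ γ.1 0 ∈ φ.source
      · have hc' : φ ∈ LocalCharts n M ∧ γ'.1 0 ∈ φ.source := h0 ▸ hc
        simp only [if_pos hc, if_pos hc']
        exact h.2 φ hc.1 hc.2
      · have hc' : ¬ (φ ∈ LocalCharts n M ∧ γ'.1 0 ∈ φ.source) := h0 ▸ hc
        simp only [if_neg hc, if_neg hc'])

/-- The polynomial curve `t ↦ Σ_α t^α y^(α)` in the coordinate space of `M`. -/
def polyCurve (p : JetModel n k) (t : ℝ) : EuclideanSpace ℝ (Fin n) :=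
  ∑ α : Fin (k + 1), t ^ (α : ℕ) • p α

lemma polyCurve_zero (p : JetModel n k) : polyCurve p 0 = p 0 := by
  unfold polyCurve
  rw [Finset.sum_eq_single (0 : Fin (k + 1))]
  · simp
  · intro b _ hb
    have : (b : ℕ) ≠ 0 := fun h => hb (Fin.ext (by simpa using h))
    simp [this]
  · simp

lemma contDiff_polyCurve_uncurry :
    ContDiff ℝ ∞ (fun q : JetModel n k × ℝ => polyCurve q.1 q.2) := by
  unfold polyCurve
  fun_prop

lemma contDiff_polyCurve (p : JetModel n k) : ContDiff ℝ ∞ (polyCurve p) := by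
  unfold polyCurve
  fun_prop

lemma iteratedDeriv_polyCurve (p : JetModel n k) (α : Fin (k + 1)) :
    iteratedDeriv (α : ℕ) (polyCurve p) 0 = (Nat.factorial α : ℝ) • p α := by
  have h : polyCurve p = fun t : ℝ => ∑ β : Fin (k + 1), t ^ (β : ℕ) • p β := rfl
  rw [h, iteratedDeriv_fun_sum (fun i _ => by fun_prop), Finset.sum_eq_single α]
  · have := iteratedDeriv_smul_const (n := (α : ℕ)) (x := (0 : ℝ)) (f := fun t : ℝ => t ^ (α : ℕ))
      (by fun_prop) (p α)
    rw [this, iteratedDeriv_fun_pow_zero]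
    simp
  · intro β _ hβ
    have := iteratedDeriv_smul_const (n := (α : ℕ)) (x := (0 : ℝ)) (f := fun t : ℝ => t ^ (β : ℕ))
      (by fun_prop) (p β)
    rw [this, iteratedDeriv_fun_pow_zero]
    have hne : (α : ℕ) ≠ (β : ℕ) := fun h => hβ (Fin.ext h.symm)
    simp [hne]
  · simp

lemma contMDiffAt_symm_polyCurve {φ : OpenPartialHomeomorph M (EuclideanSpace ℝ (Fin n))}
    (hφ : φ ∈ LocalCharts n M) {p : JetModel n k} (hp : p 0 ∈ φ.target) :
    ContMDiffAt 𝓘(ℝ, ℝ) (𝓡 n) ∞ (fun t => φ.symm (polyCurve p t)) 0 := by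
  have h1 : ContMDiffAt (𝓡 n) (𝓡 n) ∞ φ.symm (polyCurve p 0) :=
    contMDiffAt_symm_of_mem_maximalAtlas hφ (by rwa [polyCurve_zero])
  exact h1.comp 0 (contDiff_polyCurve p).contMDiff.contMDiffAt

open Classical in
/-- The inverse of the induced coordinates: the jet of the curve with the given Taylor
coefficients in the chart. -/
def jetInv (φ : OpenPartialHomeomorph M (EuclideanSpace ℝ (Fin n))) (p : JetModel n k) :
    AccBundle n k M :=
  if h : φ ∈ LocalCharts n M ∧ p 0 ∈ φ.target then
    AccBundle.mk k ⟨fun t => φ.symm (polyCurve p t), contMDiffAt_symm_polyCurve h.1 h.2⟩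
  else AccBundle.null k (φ.symm (p 0))

lemma contDiffAt_chart_comp {φ : OpenPartialHomeomorph M (EuclideanSpace ℝ (Fin n))}
    (hφ : φ ∈ LocalCharts n M) (γ : SmoothCurve n M) (h : γ.1 0 ∈ φ.source) :
    ContDiffAt ℝ ∞ (φ ∘ γ.1) 0 := by
  have h1 : ContMDiffAt (𝓡 n) (𝓡 n) ∞ φ (γ.1 0) := contMDiffAt_of_mem_maximalAtlas hφ h
  exact (h1.comp 0 γ.2).contDiffAt

lemma contDiffAt_chart_trans {φ ψ : OpenPartialHomeomorph M (EuclideanSpace ℝ (Fin n))}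
    (hφ : φ ∈ LocalCharts n M) (hψ : ψ ∈ LocalCharts n M) {x : EuclideanSpace ℝ (Fin n)}
    (hx : x ∈ φ.target) (hx' : φ.symm x ∈ ψ.source) :
    ContDiffAt ℝ ∞ (ψ ∘ φ.symm) x := by
  have h1 : ContMDiffAt (𝓡 n) (𝓡 n) ∞ φ.symm x := contMDiffAt_symm_of_mem_maximalAtlas hφ hx
  have h2 : ContMDiffAt (𝓡 n) (𝓡 n) ∞ ψ (φ.symm x) := contMDiffAt_of_mem_maximalAtlas hψ hx'
  exact (h2.comp x h1).contDiffAt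

/-- Taylor coefficients of a composition depend only on the Taylor coefficients of the inner
curve. -/
lemma iteratedDeriv_comp_congr {E F : Type*} [NormedAddCommGroup E] [NormedSpace ℝ E]
    [NormedAddCommGroup F] [NormedSpace ℝ F] {g : E → F} {f f' : ℝ → E}
    (hg : ContDiffAt ℝ ∞ g (f 0)) (hf : ContDiffAt ℝ ∞ f 0) (hf' : ContDiffAt ℝ ∞ f' 0)
    {k : ℕ} (h : ∀ j ≤ k, iteratedDeriv j f 0 = iteratedDeriv j f' 0) :
    ∀ j ≤ k, iteratedDeriv j (g ∘ f) 0 = iteratedDeriv j (g ∘ f') 0 := by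
  intro j hj
  have h0 : f 0 = f' 0 := by simpa using h 0 (Nat.zero_le _)
  have hj' : (j : ℕ∞ω) ≤ ∞ := by exact_mod_cast le_top
  rw [iteratedDeriv_vcomp_eq_sum_orderedFinpartition hg hf hj',
    iteratedDeriv_vcomp_eq_sum_orderedFinpartition (h0 ▸ hg) hf' hj', h0]
  refine Finset.sum_congr rfl fun c _ => ?_
  congr 1
  funext i
  exact h _ ((c.partSize_le i).trans hj)

lemma jetCoord_mk {φ : OpenPartialHomeomorph M (EuclideanSpace ℝ (Fin n))}
    (hφ : φ ∈ LocalCharts n M) (γ : SmoothCurve n M) (h : γ.1 0 ∈ φ.source) :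
    jetCoord k φ (AccBundle.mk k γ) = curveCoord k φ γ.1 :=
  if_pos (⟨hφ, h⟩ : φ ∈ LocalCharts n M ∧ γ.1 0 ∈ φ.source)

lemma jetCoord_zero {φ : OpenPartialHomeomorph M (EuclideanSpace ℝ (Fin n))}
    (hφ : φ ∈ LocalCharts n M) (u : AccBundle n k M) (h : u.proj ∈ φ.source) :
    jetCoord k φ u 0 = φ u.proj := by
  induction u using Quotient.inductionOn with
  | h γ =>
    have := jetCoord_mk (k := k) hφ γ h
    change jetCoord k φ (AccBundle.mk k γ) 0 = φ (γ.1 0)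
    rw [this]
    simp [curveCoord]

lemma jetInv_eq {φ : OpenPartialHomeomorph M (EuclideanSpace ℝ (Fin n))}
    (hφ : φ ∈ LocalCharts n M) {p : JetModel n k} (hp : p 0 ∈ φ.target) :
    jetInv φ p = AccBundle.mk k
      ⟨fun t => φ.symm (polyCurve p t), contMDiffAt_symm_polyCurve hφ hp⟩ :=
  dif_pos (⟨hφ, hp⟩ : φ ∈ LocalCharts n M ∧ p 0 ∈ φ.target)

lemma proj_jetInv {φ : OpenPartialHomeomorph M (EuclideanSpace ℝ (Fin n))}
    (hφ : φ ∈ LocalCharts n M) {p : JetModel n k} (hp : p 0 ∈ φ.target) :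
    (jetInv φ p).proj = φ.symm (p 0) := by
  rw [jetInv_eq hφ hp]
  change φ.symm (polyCurve p 0) = _
  rw [polyCurve_zero]

lemma jetCoord_jetInv' {φ ψ : OpenPartialHomeomorph M (EuclideanSpace ℝ (Fin n))}
    (hφ : φ ∈ LocalCharts n M) (hψ : ψ ∈ LocalCharts n M) {p : JetModel n k}
    (hp : p 0 ∈ φ.target) (hp' : φ.symm (p 0) ∈ ψ.source) (α : Fin (k + 1)) :
    jetCoord k ψ (jetInv φ p) α =
      (Nat.factorial α : ℝ)⁻¹ • iteratedDeriv (α : ℕ) (fun t => (ψ ∘ φ.symm) (polyCurve p t)) 0 := by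
  rw [jetInv_eq hφ hp, jetCoord_mk hψ _ (by
    change φ.symm (polyCurve p 0) ∈ _
    rwa [polyCurve_zero])]
  rfl

lemma jetCoord_jetInv {φ : OpenPartialHomeomorph M (EuclideanSpace ℝ (Fin n))}
    (hφ : φ ∈ LocalCharts n M) {p : JetModel n k} (hp : p 0 ∈ φ.target) :
    jetCoord k φ (jetInv φ p) = p := by
  funext α
  rw [jetCoord_jetInv' hφ hφ hp (φ.map_target hp)]
  have hev : (fun t => (φ ∘ φ.symm) (polyCurve p t)) =ᶠ[nhds 0] polyCurve p := by
    have hc : ContinuousAt (polyCurve p) 0 := (contDiff_polyCurve p).continuous.continuousAt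
    have : φ.target ∈ nhds (polyCurve p 0) :=
      φ.open_target.mem_nhds (by rwa [polyCurve_zero])
    filter_upwards [hc this] with t ht
    exact φ.right_inv ht
  rw [hev.iteratedDeriv_eq, iteratedDeriv_polyCurve, smul_smul,
    inv_mul_cancel₀ (by positivity), one_smul]

lemma jetInv_jetCoord {φ : OpenPartialHomeomorph M (EuclideanSpace ℝ (Fin n))}
    (hφ : φ ∈ LocalCharts n M) {u : AccBundle n k M} (hu : u.proj ∈ φ.source) :
    jetInv φ (jetCoord k φ u) = u := by
  have h0 : jetCoord k φ u 0 ∈ φ.target := by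
    rw [jetCoord_zero hφ u hu]
    exact φ.map_source hu
  have hb : φ.symm (jetCoord k φ u 0) = u.proj := by
    rw [jetCoord_zero hφ u hu, φ.left_inv hu]
  rw [jetInv_eq hφ h0]
  induction u using Quotient.inductionOn with
  | h γ =>
    have hγ : γ.1 0 ∈ φ.source := hu
    have hmk := jetCoord_mk (k := k) hφ γ hγ
    refine Quotient.sound ?_
    set p := jetCoord k φ (Quotient.mk (jetSetoid n k M) γ) with hpdef
    have hp : p = curveCoord k φ γ.1 := hmk
    have hstart : φ.symm (polyCurve p 0) = γ.1 0 := by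
      rw [polyCurve_zero]; exact hb
    refine ⟨hstart, fun ψ hψ hs => ?_⟩
    have hs' : γ.1 0 ∈ ψ.source := hstart ▸ hs
    have hφγ := contDiffAt_chart_comp hφ γ hγ
    have hjets : ∀ j ≤ k, iteratedDeriv j (polyCurve p) 0 = iteratedDeriv j (φ ∘ γ.1) 0 := by
      intro j hj
      have := iteratedDeriv_polyCurve p ⟨j, Nat.lt_succ_of_le hj⟩
      rw [this, hp]
      simp only [curveCoord, smul_smul]
      rw [mul_inv_cancel₀ (by positivity), one_smul]
    have hg : ContDiffAt ℝ ∞ (ψ ∘ φ.symm) (polyCurve p 0) := by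
      refine contDiffAt_chart_trans hφ hψ ?_ hs
      rw [polyCurve_zero]; exact h0
    have key := iteratedDeriv_comp_congr hg (contDiff_polyCurve p).contDiffAt hφγ hjets
    have hev : ψ ∘ γ.1 =ᶠ[nhds 0] (ψ ∘ φ.symm) ∘ (φ ∘ γ.1) := by
      have : φ.source ∈ nhds (γ.1 0) := φ.open_source.mem_nhds hγ
      filter_upwards [γ.2.continuousAt this] with t ht
      simp [φ.left_inv ht]
    funext α
    simp only [curveCoord]
    rw [hev.iteratedDeriv_eq, ← key α (Nat.lt_succ_iff.mp α.2)]
    rfl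

/-- The induced chart of `T^k M` as a partial equivalence. -/
def jetPartialEquiv (k : ℕ) (φ : OpenPartialHomeomorph M (EuclideanSpace ℝ (Fin n)))
    (hφ : φ ∈ LocalCharts n M) : PartialEquiv (AccBundle n k M) (JetModel n k) where
  toFun := jetCoord k φ
  invFun := jetInv φ
  source := {u | u.proj ∈ φ.source}
  target := {p | p 0 ∈ φ.target}
  map_source' u hu := by
    change jetCoord k φ u 0 ∈ φ.target
    rw [jetCoord_zero hφ u hu]
    exact φ.map_source hu
  map_target' p hp := by
    change (jetInv φ p).proj ∈ φ.source
    rw [proj_jetInv hφ hp]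
    exact φ.map_target hp
  left_inv' _ hu := jetInv_jetCoord hφ hu
  right_inv' _ hp := jetCoord_jetInv hφ hp

/-- Iterated derivatives of a smooth family of curves depend smoothly on the parameter. -/
lemma contDiffAt_iteratedDeriv_param {P F : Type*} [NormedAddCommGroup P] [NormedSpace ℝ P]
    [NormedAddCommGroup F] [NormedSpace ℝ F] (j : ℕ) {H : P → ℝ → F} {p : P}
    (hH : ContDiffAt ℝ ∞ (Function.uncurry H) (p, 0)) :
    ContDiffAt ℝ ∞ (fun q => iteratedDeriv j (H q) 0) p := by
  induction j generalizing H with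
  | zero =>
    simp only [iteratedDeriv_zero]
    exact hH.comp p (f := fun q : P => (q, (0 : ℝ))) (by fun_prop)
  | succ j ih =>
    simp only [iteratedDeriv_succ']
    refine ih (H := fun q => deriv (H q)) ?_
    have h1 : ContDiffAt ℝ ∞
        (fun r : P × ℝ => fderiv ℝ (fun s : ℝ => H r.1 s) r.2) (p, (0 : ℝ)) := by
      refine ContDiffAt.fderiv (n := ∞) (f := fun (r : P × ℝ) (s : ℝ) => H r.1 s)
        (g := fun r : P × ℝ => r.2) ?_ (by fun_prop) (by simp)
      exact ContDiffAt.comp (g := Function.uncurry H)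
        (f := fun z : (P × ℝ) × ℝ => (z.1.1, z.2)) ((p, (0 : ℝ)), (0 : ℝ)) hH (by fun_prop)
    have h2 : ContDiffAt ℝ ∞
        (fun r : P × ℝ => fderiv ℝ (fun s : ℝ => H r.1 s) r.2 (1 : ℝ)) (p, (0 : ℝ)) :=
      h1.clm_apply contDiffAt_const
    exact h2

lemma trans_source_eq {φ ψ : OpenPartialHomeomorph M (EuclideanSpace ℝ (Fin n))}
    (hφ : φ ∈ LocalCharts n M) (hψ : ψ ∈ LocalCharts n M) :
    ((jetPartialEquiv k φ hφ).symm.trans (jetPartialEquiv k ψ hψ)).source =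
      (fun p : JetModel n k => p 0) ⁻¹' (φ.symm.trans ψ).source := by
  ext p
  simp only [PartialEquiv.trans_source, Set.mem_inter_iff, Set.mem_preimage,
    OpenPartialHomeomorph.trans_source]
  refine and_congr_right fun hp => ?_
  change (jetInv φ p).proj ∈ ψ.source ↔ φ.symm (p 0) ∈ ψ.source
  rw [proj_jetInv hφ hp]

/-- The coordinate changes of `T^k M` are smooth. -/
lemma contDiffOn_jetTrans {φ ψ : OpenPartialHomeomorph M (EuclideanSpace ℝ (Fin n))}
    (hφ : φ ∈ LocalCharts n M) (hψ : ψ ∈ LocalCharts n M) :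
    ContDiffOn ℝ ∞ ((jetPartialEquiv k φ hφ).symm.trans (jetPartialEquiv k ψ hψ))
      ((jetPartialEquiv k φ hφ).symm.trans (jetPartialEquiv k ψ hψ)).source := by
  rw [trans_source_eq hφ hψ]
  intro p hp
  have hp1 : p 0 ∈ φ.target := hp.1
  have hp2 : φ.symm (p 0) ∈ ψ.source := hp.2
  have hsm : ContDiffAt ℝ ∞ (fun q : JetModel n k => fun α : Fin (k + 1) =>
      (Nat.factorial α : ℝ)⁻¹ • iteratedDeriv (α : ℕ) (fun t => (ψ ∘ φ.symm) (polyCurve q t)) 0) p := by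
    refine contDiffAt_pi.2 fun α => ContDiffAt.const_smul _ ?_
    refine contDiffAt_iteratedDeriv_param (α : ℕ)
      (H := fun (q : JetModel n k) t => (ψ ∘ φ.symm) (polyCurve q t)) ?_
    refine ContDiffAt.comp (g := ψ ∘ φ.symm)
      (f := fun z : JetModel n k × ℝ => polyCurve z.1 z.2) (p, (0 : ℝ)) ?_
      contDiff_polyCurve_uncurry.contDiffAt
    simp only [polyCurve_zero]
    exact contDiffAt_chart_trans hφ hψ hp1 hp2
  refine hsm.contDiffWithinAt.congr (fun q hq => ?_) ?_
  · funext α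
    exact jetCoord_jetInv' hφ hψ hq.1 hq.2 α
  · funext α
    exact jetCoord_jetInv' hφ hψ hp1 hp2 α

variable (n k M) in
/-- The atlas of `T^k M` induced by the smooth atlas of `M`. -/
def accCore [IsManifold (𝓡 n) ∞ M] : ChartedSpaceCore (JetModel n k) (AccBundle n k M) where
  atlas := {e | ∃ (φ : OpenPartialHomeomorph M (EuclideanSpace ℝ (Fin n)))
    (hφ : φ ∈ LocalCharts n M), e = jetPartialEquiv k φ hφ}
  chartAt u := jetPartialEquiv k (chartAt (EuclideanSpace ℝ (Fin n)) u.proj)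
    (IsManifold.chart_mem_maximalAtlas u.proj)
  mem_chart_source u := mem_chart_source (EuclideanSpace ℝ (Fin n)) u.proj
  chart_mem_atlas u := ⟨_, IsManifold.chart_mem_maximalAtlas u.proj, rfl⟩
  open_source := by
    rintro _ _ ⟨φ, hφ, rfl⟩ ⟨ψ, hψ, rfl⟩
    rw [trans_source_eq hφ hψ]
    exact (φ.symm.trans ψ).open_source.preimage (continuous_apply 0)
  continuousOn_toFun := by
    rintro _ _ ⟨φ, hφ, rfl⟩ ⟨ψ, hψ, rfl⟩
    exact (contDiffOn_jetTrans hφ hψ).continuousOn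

instance instTopologicalSpaceAccBundle [IsManifold (𝓡 n) ∞ M] :
    TopologicalSpace (AccBundle n k M) :=
  (accCore n k M).toTopologicalSpace

instance instChartedSpaceAccBundle [IsManifold (𝓡 n) ∞ M] :
    ChartedSpace (JetModel n k) (AccBundle n k M) :=
  (accCore n k M).toChartedSpace

/-- `T^k M` is a smooth manifold of dimension `(k + 1) n`. -/
instance instIsManifoldAccBundle [IsManifold (𝓡 n) ∞ M] :
    IsManifold 𝓘(ℝ, JetModel n k) ∞ (AccBundle n k M) := by
  refine isManifold_of_contDiffOn _ _ _ fun e e' he he' => ?_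
  have hat : atlas (JetModel n k) (AccBundle n k M) =
    ⋃ (e : PartialEquiv (AccBundle n k M) (JetModel n k)) (he : e ∈ (accCore n k M).atlas),
      {(accCore n k M).openPartialHomeomorph e he} := rfl
  rw [hat] at he he'
  simp only [Set.mem_iUnion, Set.mem_singleton_iff] at he he'
  obtain ⟨_, ⟨φ, hφ, rfl⟩, rfl⟩ := he
  obtain ⟨_, ⟨ψ, hψ, rfl⟩, rfl⟩ := he'
  have := contDiffOn_jetTrans (k := k) hφ hψ
  simp only [modelWithCornersSelf_coe, modelWithCornersSelf_coe_symm, Set.range_id, Set.preimage_id,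
    Set.inter_univ, Function.comp_id, Function.id_comp]
  exact this

end Bundle

/-! ### Operators in the local coordinates of `T^k M` -/

section Coordinates

variable {n k : ℕ}

/-- The coordinate vector `∂/∂y^(a)j`, where `y^(0) = x`. -/
def basisVec (a : ℕ) (j : Fin n) : JetModel n k :=
  fun β => if (β : ℕ) = a then EuclideanSpace.single j 1 else 0

/-- The partial derivative `∂f/∂y^(a)j`, where `y^(0) = x`. -/
def pderivY (a : ℕ) (j : Fin n) (f : JetModel n k → ℝ) (p : JetModel n k) : ℝ :=
  fderiv ℝ f p (basisVec a j)

/-- The derivative of `f` along the local vector field `X`. -/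
def derivAlong (X : JetModel n k → JetModel n k) (f : JetModel n k → ℝ) (p : JetModel n k) : ℝ :=
  fderiv ℝ f p (X p)

/-- The `k`-th Liouville vector field `Σ_α α y^(α)i ∂/∂y^(α)i`. -/
def liouville (p : JetModel n k) : JetModel n k :=
  fun α => ((α : ℕ) : ℝ) • p α

/-- The operator `Γ = y^(1)i ∂/∂x^i + 2 y^(2)i ∂/∂y^(1)i + ⋯ + k y^(k)i ∂/∂y^(k-1)i`. -/
def gammaField (p : JetModel n k) : JetModel n k :=
  Fin.snoc (α := fun _ => EuclideanSpace ℝ (Fin n))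
    (fun α : Fin k => (((α : ℕ) : ℝ) + 1) • p α.succ) 0

/-- The local vector field `Γ - (k+1) G^i ∂/∂y^(k)i`. -/
def semisprayField (G : Fin n → JetModel n k → ℝ) (p : JetModel n k) : JetModel n k :=
  Fin.snoc (α := fun _ => EuclideanSpace ℝ (Fin n))
    (fun α : Fin k => (((α : ℕ) : ℝ) + 1) • p α.succ)
    (WithLp.toLp 2 fun i => -(((k : ℝ) + 1) * G i p))

/-- The `k`-tangent structure in coordinates: `∂/∂y^(a)i ↦ ∂/∂y^(a+1)i` for `a < k`, and
`∂/∂y^(k)i ↦ 0`. -/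
def tangentStructure (v : JetModel n k) : JetModel n k :=
  Fin.cons (α := fun _ => EuclideanSpace ℝ (Fin n)) 0 (fun α : Fin k => v α.castSucc)

/-- The dilation `(x, y^(1), …, y^(k)) ↦ (x, c y^(1), …, c^k y^(k))`. -/
def dilation (c : ℝ) (p : JetModel n k) : JetModel n k :=
  fun α => c ^ (α : ℕ) • p α

/-- The matrix `g_ij = ½ ∂²L/∂y^(k)i∂y^(k)j`. -/
def hessianMatrix (L : JetModel n k → ℝ) (p : JetModel n k) : Matrix (Fin n) (Fin n) ℝ :=
  Matrix.of fun i j => (1 / 2) * pderivY k i (pderivY k j L) p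

/-- `Γ(∂L/∂y^(k)j) - ∂L/∂y^(k-1)j`. -/
def canonicalCovector (L : JetModel n k → ℝ) (j : Fin n) (p : JetModel n k) : ℝ :=
  derivAlong gammaField (pderivY k j L) p - pderivY (k - 1) j L p

/-- The coefficients `G^i` of the canonical `k`-semispray of a Lagrangian `L`:
`(k+1) G^i = ½ g^{ij} {Γ(∂L/∂y^(k)j) - ∂L/∂y^(k-1)j}`. -/
def canonicalCoeff (L : JetModel n k → ℝ) (i : Fin n) (p : JetModel n k) : ℝ :=
  (1 / ((k : ℝ) + 1)) *
    ((1 / 2) * ∑ j, (hessianMatrix L p)⁻¹ i j * canonicalCovector L j p)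

/-- The recursion `M_(1) = M₁`, `M_(a) = (1/a) (S M_(a-1) + M_(1) M_(a-1))` for `a ≥ 2`, where `S`
is the semispray with coefficients `G`. (The value at `a = 0` is never used.) -/
def dualRecursion (G : Fin n → JetModel n k → ℝ) (M₁ : Fin n → Fin n → JetModel n k → ℝ) :
    ℕ → Fin n → Fin n → JetModel n k → ℝ
  | 0 => fun _ _ _ => 0
  | 1 => M₁
  | a + 2 => fun i j p => (1 / ((a : ℝ) + 2)) *
      (derivAlong (semisprayField G) (dualRecursion G M₁ (a + 1) i j) p +
        ∑ m, M₁ i m p * dualRecursion G M₁ (a + 1) m j p)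

/-- Miron's dual coefficients `M_(a)^i_j` of a `k`-semispray with coefficients `G`. -/
def mironCoeff (G : Fin n → JetModel n k → ℝ) : ℕ → Fin n → Fin n → JetModel n k → ℝ :=
  dualRecursion G fun i j => pderivY k j (G i)

/-- Bucătaru's dual coefficients `M*_(a)^i_j = ∂G^i/∂y^(k+1-a)j`, `1 ≤ a ≤ k`. -/
def bucataruCoeff (G : Fin n → JetModel n k → ℝ) : ℕ → Fin n → Fin n → JetModel n k → ℝ :=
  fun a i j => pderivY (k + 1 - a) j (G i)

/-- The dual coefficients of the Cartan nonlinear connection, for `L = F²`. -/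
def cartanCoeff (L : JetModel n k → ℝ) : ℕ → Fin n → Fin n → JetModel n k → ℝ :=
  dualRecursion (canonicalCoeff L) fun i j p => (1 / (2 * ((k : ℝ) + 1))) *
    pderivY k j (fun q => ∑ m, (hessianMatrix L q)⁻¹ i m * canonicalCovector L m q) p

/-- The value on `v` of the 1-form
`δy^(α)i = dy^(α)i + M_(1)^i_j dy^(α-1)j + ⋯ + M_(α)^i_j dx^j` at `p`. -/
def dualForm (C : ℕ → Fin n → Fin n → JetModel n k → ℝ) (α : Fin (k + 1)) (i : Fin n)
    (p v : JetModel n k) : ℝ :=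
  v α i + ∑ β ∈ Finset.Iio α, ∑ j, C ((α : ℕ) - (β : ℕ)) i j p * v β j

end Coordinates

/-! ### `k`-semisprays and nonlinear connections on the slit bundle -/

section Objects

variable {n k : ℕ} {M : Type*} [TopologicalSpace M] [ChartedSpace (EuclideanSpace ℝ (Fin n)) M]

variable (n k M) in
/-- The open set of the points of `T^k M` with `y^(1) ≠ 0`. -/
def slit : Set (AccBundle n k M) :=
  {u | ∀ φ ∈ LocalCharts n M, u.proj ∈ φ.source → jetCoord k φ u 1 ≠ 0}

/-- The coordinate image of the slit bundle over the domain of a chart. -/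
def slitCoord (k : ℕ) (φ : OpenPartialHomeomorph M (EuclideanSpace ℝ (Fin n))) :
    Set (JetModel n k) :=
  {p | p 0 ∈ φ.target ∧ p 1 ≠ 0}

/-- The square of `F`, written in a local chart. -/
def localSq (F : AccBundle n k M → ℝ) (φ : OpenPartialHomeomorph M (EuclideanSpace ℝ (Fin n)))
    (p : JetModel n k) : ℝ :=
  F (jetInv φ p) ^ 2

variable [IsManifold (𝓡 n) ∞ M]

/-- The components of a tangent vector of `T^k M` in the induced coordinates of a chart. -/
def tangentCoord (φ : OpenPartialHomeomorph M (EuclideanSpace ℝ (Fin n))) (u : AccBundle n k M) :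
    TangentSpace 𝓘(ℝ, JetModel n k) u →L[ℝ] JetModel n k :=
  mfderiv 𝓘(ℝ, JetModel n k) 𝓘(ℝ, JetModel n k) (jetCoord k φ) u

/-- The vertical space `V₁ = ker dπ^k`, spanned by the `∂/∂y^(α)i` with `1 ≤ α ≤ k`. -/
def vertical (u : AccBundle n k M) : Submodule ℝ (TangentSpace 𝓘(ℝ, JetModel n k) u) :=
  LinearMap.ker (mfderiv 𝓘(ℝ, JetModel n k) (𝓡 n) (AccBundle.proj : AccBundle n k M → M) u).toLinearMap

open Classical in
/-- A vector field on the slit bundle, written in a local chart. -/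
def fieldCoord (X : ∀ u : slit n k M, TangentSpace 𝓘(ℝ, JetModel n k) (u : AccBundle n k M))
    (φ : OpenPartialHomeomorph M (EuclideanSpace ℝ (Fin n))) (p : JetModel n k) : JetModel n k :=
  if h : jetInv φ p ∈ slit n k M then tangentCoord φ (jetInv φ p) (X ⟨jetInv φ p, h⟩) else 0

variable (n k M) in
/-- A `k`-semispray: a smooth vector field `S` on the slit bundle such that `J S` is the `k`-th
Liouville vector field, `J` being the `k`-tangent structure. -/
@[ext]
structure KSemispray where
  /-- the underlying vector field -/
  field : ∀ u : slit n k M, TangentSpace 𝓘(ℝ, JetModel n k) (u : AccBundle n k M)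
  smooth : ∀ φ ∈ LocalCharts n M, ContDiffOn ℝ ∞ (fieldCoord field φ) (slitCoord k φ)
  tangentStructure_field : ∀ φ ∈ LocalCharts n M, ∀ u : slit n k M, u.1.proj ∈ φ.source →
    tangentStructure (tangentCoord φ u.1 (field u)) = liouville (jetCoord k φ u.1)

/-- The coefficients `G^i` of a `k`-semispray in a chart: the `∂/∂y^(k)i`-component of `S` is
`-(k+1) G^i`. -/
def KSemispray.coeff (S : KSemispray n k M)
    (φ : OpenPartialHomeomorph M (EuclideanSpace ℝ (Fin n))) (i : Fin n) (p : JetModel n k) : ℝ :=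
  -(1 / ((k : ℝ) + 1)) * fieldCoord S.field φ p (Fin.last k) i

/-- A `k`-semispray is a `k`-spray if its coefficients are `(k+1)`-homogeneous. -/
def KSemispray.IsSpray (S : KSemispray n k M) : Prop :=
  ∀ φ ∈ LocalCharts n M, ∀ i, ∀ p ∈ slitCoord k φ, ∀ c : ℝ, 0 < c →
    S.coeff φ i (dilation c p) = c ^ (k + 1) * S.coeff φ i p

variable (n k M) in
/-- A nonlinear connection: a smooth distribution on the slit bundle supplementary to the vertical
distribution. -/
@[ext]
structure NonlinearConnection where
  /-- the horizontal spaces -/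
  horizontal : ∀ u : slit n k M, Submodule ℝ (TangentSpace 𝓘(ℝ, JetModel n k) (u : AccBundle n k M))
  isCompl : ∀ u : slit n k M, IsCompl (horizontal u) (vertical u.1)
  smooth : ∀ φ ∈ LocalCharts n M, ∃ H : JetModel n k → EuclideanSpace ℝ (Fin n) →L[ℝ] JetModel n k,
    ContDiffOn ℝ ∞ H (slitCoord k φ) ∧ ∀ u : slit n k M, u.1.proj ∈ φ.source →
      ∀ X : TangentSpace 𝓘(ℝ, JetModel n k) (u : AccBundle n k M),
        X ∈ horizontal u ↔ ∃ e, tangentCoord φ u.1 X = H (jetCoord k φ u.1) e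

/-- `C a i j = M_(a)^i_j`, `1 ≤ a ≤ k`, are the dual coefficients of `N` in the chart `φ`: the
horizontal spaces are the common kernels of the forms `δy^(α)i`, `1 ≤ α ≤ k`. -/
def NonlinearConnection.HasDualCoeff (N : NonlinearConnection n k M)
    (φ : OpenPartialHomeomorph M (EuclideanSpace ℝ (Fin n)))
    (C : ℕ → Fin n → Fin n → JetModel n k → ℝ) : Prop :=
  ∀ u : slit n k M, u.1.proj ∈ φ.source →
    ∀ X : TangentSpace 𝓘(ℝ, JetModel n k) (u : AccBundle n k M),
      X ∈ N.horizontal u ↔ ∀ α : Fin (k + 1), α ≠ 0 → ∀ i,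
        dualForm C α i (jetCoord k φ u.1) (tangentCoord φ u.1 X) = 0

/-- Miron's nonlinear connection of a `k`-semispray. -/
def IsMironConnection (S : KSemispray n k M) (N : NonlinearConnection n k M) : Prop :=
  ∀ φ ∈ LocalCharts n M, N.HasDualCoeff φ (mironCoeff (S.coeff φ))

/-- Bucătaru's nonlinear connection of a `k`-semispray. -/
def IsBucataruConnection (S : KSemispray n k M) (N : NonlinearConnection n k M) : Prop :=
  ∀ φ ∈ LocalCharts n M, N.HasDualCoeff φ (bucataruCoeff (S.coeff φ))

/-- `S'` is the `k`-semispray that follows `S`: its coefficients are `1/(k+1)` times the derivatives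
of those of `S` along the `k`-th Liouville vector field. -/
def IsNextSemispray (S S' : KSemispray n k M) : Prop :=
  ∀ φ ∈ LocalCharts n M, ∀ i, ∀ p ∈ slitCoord k φ,
    S'.coeff φ i p = (1 / ((k : ℝ) + 1)) * derivAlong liouville (S.coeff φ i) p

/-- The sequences `(S^m)`, `(N^m)`, `(N*^m)`, `m ≥ 1`, constructed from the `k`-semispray `S₁`. -/
structure IsSequenceFrom (S₁ : KSemispray n k M) (S : ℕ+ → KSemispray n k M)
    (N Nstar : ℕ+ → NonlinearConnection n k M) : Prop where
  start : S 1 = S₁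
  next : ∀ m, IsNextSemispray (S m) (S (m + 1))
  miron : ∀ m, IsMironConnection (S m) (N m)
  bucataru : ∀ m, IsBucataruConnection (S m) (Nstar m)

/-- `(M, F)` is a Finsler space of order `k`. -/
structure IsFinslerSpace (F : AccBundle n k M → ℝ) : Prop where
  smooth : ContMDiffOn 𝓘(ℝ, JetModel n k) 𝓘(ℝ, ℝ) ∞ F (slit n k M)
  continuousAt_null : ∀ x : M, ContinuousAt F (AccBundle.null k x)
  pos : ∀ u ∈ slit n k M, 0 < F u
  homogeneous : ∀ φ ∈ LocalCharts n M, ∀ p : JetModel n k, p 0 ∈ φ.target → ∀ c : ℝ, 0 < c →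
    F (jetInv φ (dilation c p)) = c ^ k * F (jetInv φ p)
  posDef : ∀ φ ∈ LocalCharts n M, ∀ p ∈ slitCoord k φ, (hessianMatrix (localSq F φ) p).PosDef

/-- `S` is the canonical `k`-semispray `S_{F²}`. -/
def IsCanonicalSemispray (F : AccBundle n k M → ℝ) (S : KSemispray n k M) : Prop :=
  ∀ φ ∈ LocalCharts n M, ∀ i, ∀ p ∈ slitCoord k φ,
    S.coeff φ i p = canonicalCoeff (localSq F φ) i p

/-- `N` is the Cartan nonlinear connection of `(M, F)`. -/
def IsCartanConnection (F : AccBundle n k M → ℝ) (N : NonlinearConnection n k M) : Prop :=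
  ∀ φ ∈ LocalCharts n M, N.HasDualCoeff φ (cartanCoeff (localSq F φ))

/-- `N` is Bucătaru's connection for the Lagrangian `L = F²`. -/
def IsBucataruConnectionOfSq (F : AccBundle n k M → ℝ) (N : NonlinearConnection n k M) : Prop :=
  ∀ φ ∈ LocalCharts n M, N.HasDualCoeff φ (bucataruCoeff (canonicalCoeff (localSq F φ)))

end Objects

end HigherTangent

end

/-! Constancy is Euler's theorem. The canonical coefficients are homogeneous of weight k+1 under the
dilations (`canonicalCoeff_dilation`), so the Liouville field multiplies them by k+1
(`derivAlong_liouville`) and S_{F²} is its own successor. A semispray is determined by its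
coefficients (`KSemispray.ext_coeff`) and a connection by its dual coefficients
(`NonlinearConnection.eq_of_hasDualCoeff`), so all three sequences are constant. The Cartan
coefficients are Miron's coefficients of the canonical semispray (`cartanCoeff_eqOn`).

The bulk of the work is existence: the local formulas must define global objects. In a chart a jet
is a polynomial curve, and a change of charts τ takes Taylor coefficients of its image (`prolong`,
`jetMap`). The Jacobian matrix of `jetMap` is block Toeplitz, with blocks A_b = `coordMat τ b`, the
Taylor coefficients of Dτ along the curve. Γ acts as the time derivative, so every semispray S
satisfies S A_b = (b+1) A_{b+1} for b < k.

With M_(0) = 1, dual coefficients become a series M(t) = Σ M_(a) t^a modulo t^{k+1}, and they define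
a distribution independent of the chart once M'(t) A(t) = A_0 M(t) (`DualLaw`,
`exists_nonlinearConnection`). Bucătaru's coefficients obey this law because it is the derivative of
the transformation law of G (`dualLaw_bucataruCoeff`). Miron's obey it by induction, differentiating
the law along S (`dualLaw_mironCoeff`).

The canonical semispray is characterized by S(∂L/∂y^(k)j) = ∂L/∂y^(k-1)j (`eq_canonicalCoeff_iff`).
Under a change of charts both sides acquire the same term in A_1 and are otherwise multiplied by the
invertible matrix A_0, so the condition is invariant (`fderiv_jetMap_canonical`). -/

noncomputable section

namespace HigherTangent

/-! ### Taylor coefficients of curves as functions on jet space. -/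

section Prolongation

/-- Differentiation in a parameter commutes with differentiation in time. -/
lemma fderiv_deriv_comm {P F : Type*} [NormedAddCommGroup P] [NormedSpace ℝ P]
    [NormedAddCommGroup F] [NormedSpace ℝ F] {H : P → ℝ → F} {p : P} {t : ℝ}
    (hH : ContDiffAt ℝ 2 (Function.uncurry H) (p, t)) (v : P) :
    fderiv ℝ (fun q => deriv (H q) t) p v = deriv (fun s => fderiv ℝ (fun q => H q s) p v) t := by
  set U := Function.uncurry H
  have hev : ∀ᶠ z in nhds (p, t), DifferentiableAt ℝ U z :=
    (hH.eventually (by simp)).mono fun z hz => hz.differentiableAt (by simp)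
  have hd : DifferentiableAt ℝ (fderiv ℝ U) (p, t) :=
    (hH.fderiv_right (m := 1) (by norm_num)).differentiableAt (by simp)
  have hc1 : ContinuousAt (fun q : P => (q, t)) p := by fun_prop
  have hc2 : ContinuousAt (fun s : ℝ => (p, s)) t := by fun_prop
  -- Both mixed derivatives are values of the second Fréchet derivative of the uncurried map; its
  -- symmetry concludes.
  have e1 : (fun q => deriv (H q) t) =ᶠ[nhds p] fun q => fderiv ℝ U (q, t) (0, 1) := by
    filter_upwards [hc1.eventually hev] with q hq
    have : HasDerivAt (fun s : ℝ => (q, s)) ((0 : P), (1 : ℝ)) t :=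
      (hasDerivAt_const t q).prodMk (hasDerivAt_id t)
    exact (hq.hasFDerivAt.comp_hasDerivAt t this).deriv
  have e2 : (fun s => fderiv ℝ (fun q => H q s) p v) =ᶠ[nhds t]
      fun s => fderiv ℝ U (p, s) (v, 0) := by
    filter_upwards [hc2.eventually hev] with s hs
    have : HasFDerivAt (fun q : P => (q, s)) (ContinuousLinearMap.inl ℝ P ℝ) p :=
      hasFDerivAt_prodMk_left p s
    have h2 : HasFDerivAt (fun q => H q s) _ p :=
      HasFDerivAt.comp (g := U) (f := fun q : P => (q, s)) p hs.hasFDerivAt this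
    rw [h2.fderiv]
    simp
  rw [e1.fderiv_eq, e2.deriv_eq]
  have h1 : HasFDerivAt (fun q => fderiv ℝ U (q, t) (0, 1)) _ p :=
    (HasFDerivAt.comp (g := fderiv ℝ U) (f := fun q : P => (q, t)) p hd.hasFDerivAt
      (hasFDerivAt_prodMk_left p t)).clm_apply (hasFDerivAt_const ((0 : P), (1 : ℝ)) p)
  have h2 : HasDerivAt (fun s => fderiv ℝ U (p, s) (v, 0)) _ t :=
    (HasFDerivAt.comp_hasDerivAt (l := fderiv ℝ U) (f := fun s : ℝ => (p, s)) t hd.hasFDerivAt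
      ((hasDerivAt_const t p).prodMk (hasDerivAt_id t))).clm_apply
      (hasDerivAt_const t ((v : P), (0 : ℝ)))
  rw [h1.fderiv, h2.deriv]
  have hs := hH.isSymmSndFDerivAt (by simp)
  simpa using hs (v, 0) (0, 1)

/-- Induction on `j` with `H` generalized: one time derivative is absorbed into the family, and
`fderiv_deriv_comm` interchanges it with the parameter derivative at all times near 0, which is
enough for the other `j` derivatives. -/
lemma fderiv_iteratedDeriv_comm {P F : Type*} [NormedAddCommGroup P] [NormedSpace ℝ P]
    [NormedAddCommGroup F] [NormedSpace ℝ F] (j : ℕ) {H : P → ℝ → F} {p : P}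
    (hH : ContDiffAt ℝ ∞ (Function.uncurry H) (p, 0)) (v : P) :
    fderiv ℝ (fun q => iteratedDeriv j (H q) 0) p v =
      iteratedDeriv j (fun t => fderiv ℝ (fun q => H q t) p v) 0 := by
  induction j generalizing H with
  | zero => simp
  | succ j ih =>
    have h1 : ContDiffAt ℝ ∞ (Function.uncurry fun q => deriv (H q)) (p, (0 : ℝ)) := by
      have h1 : ContDiffAt ℝ ∞
          (fun r : P × ℝ => fderiv ℝ (fun s : ℝ => H r.1 s) r.2) (p, (0 : ℝ)) := by
        refine ContDiffAt.fderiv (n := ∞) (f := fun (r : P × ℝ) (s : ℝ) => H r.1 s)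
          (g := fun r : P × ℝ => r.2) ?_ (by fun_prop) (by simp)
        exact ContDiffAt.comp (g := Function.uncurry H)
          (f := fun z : (P × ℝ) × ℝ => (z.1.1, z.2)) ((p, (0 : ℝ)), (0 : ℝ)) hH (by fun_prop)
      exact h1.clm_apply (contDiffAt_const (c := (1 : ℝ)))
    simp only [iteratedDeriv_succ']
    rw [ih h1]
    have hev : ∀ᶠ z in nhds (p, (0 : ℝ)), ContDiffAt ℝ 2 (Function.uncurry H) z :=
      (hH.of_le (WithTop.coe_le_coe.2 le_top)).eventually (by simp)
    have hc2 : ContinuousAt (fun s : ℝ => (p, s)) 0 := by fun_prop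
    refine Filter.EventuallyEq.iteratedDeriv_eq j ?_
    filter_upwards [hc2.eventually hev] with t ht
    exact fderiv_deriv_comm ht v

/-- Taylor coefficients at `0` of a product with a power of the variable. -/
lemma iteratedDeriv_pow_smul {F : Type*} [NormedAddCommGroup F] [NormedSpace ℝ F] {h : ℝ → F}
    (hh : ContDiffAt ℝ ∞ h 0) (a b : ℕ) :
    (b.factorial : ℝ)⁻¹ • iteratedDeriv b (fun t => t ^ a • h t) 0 =
      if a ≤ b then ((b - a).factorial : ℝ)⁻¹ • iteratedDeriv (b - a) h 0 else 0 := by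
  have key := iteratedDerivWithin_smul (n := b) (x := (0 : ℝ)) (s := Set.univ) (Set.mem_univ _)
    uniqueDiffOn_univ (f := fun t : ℝ => t ^ a) (g := h) (by fun_prop)
    (hh.of_le (by exact_mod_cast le_top)).contDiffWithinAt
  simp only [iteratedDerivWithin_univ] at key
  have e : (fun t => t ^ a • h t) = (fun t : ℝ => t ^ a) • h := rfl
  rw [e, key]
  simp only [iteratedDeriv_fun_pow_zero]
  split_ifs with hab
  -- In the Leibniz sum at 0 only the `a`-th derivative of `t ^ a` survives, and `choose b a * a! /
  -- b! = 1 / (b - a)!`.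
  · rw [Finset.sum_eq_single a]
    · rw [if_pos rfl, ← Nat.cast_smul_eq_nsmul ℝ, smul_smul, smul_smul]
      congr 1
      rw [Nat.cast_choose ℝ hab]
      field_simp
    · intro i _ hi
      simp [hi]
    · intro h
      exact absurd (Finset.mem_range.2 (by omega)) h
  · rw [Finset.sum_eq_zero, smul_zero]
    intro i hi
    have : i ≠ a := by
      have := Finset.mem_range.1 hi
      omega
    simp [this]

variable {n k : ℕ} {F : Type*} [NormedAddCommGroup F] [NormedSpace ℝ F]

/-- The `b`-th Taylor coefficient of the image under `g` of the polynomial curve of `p`. -/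
def prolong (g : EuclideanSpace ℝ (Fin n) → F) (b : ℕ) (p : JetModel n k) : F :=
  (b.factorial : ℝ)⁻¹ • iteratedDeriv b (fun t => g (polyCurve p t)) 0

lemma contDiffAt_comp_polyCurve_uncurry {g : EuclideanSpace ℝ (Fin n) → F} {p : JetModel n k}
    (hg : ContDiffAt ℝ ∞ g (p 0)) :
    ContDiffAt ℝ ∞ (Function.uncurry fun (q : JetModel n k) t => g (polyCurve q t)) (p, 0) := by
  refine ContDiffAt.comp (g := g)
      (f := fun z : JetModel n k × ℝ => polyCurve z.1 z.2) (p, (0 : ℝ)) ?_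
      contDiff_polyCurve_uncurry.contDiffAt
  simpa only [polyCurve_zero]

lemma contDiffAt_comp_polyCurve {g : EuclideanSpace ℝ (Fin n) → F} {p : JetModel n k}
    (hg : ContDiffAt ℝ ∞ g (p 0)) : ContDiffAt ℝ ∞ (fun t => g (polyCurve p t)) 0 :=
  (contDiffAt_comp_polyCurve_uncurry hg).comp (0 : ℝ) (f := fun t : ℝ => (p, t)) (by fun_prop)

lemma contDiffAt_prolong {g : EuclideanSpace ℝ (Fin n) → F} {p : JetModel n k}
    (hg : ContDiffAt ℝ ∞ g (p 0)) (b : ℕ) : ContDiffAt ℝ ∞ (prolong (k := k) g b) p :=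
  (contDiffAt_iteratedDeriv_param b (contDiffAt_comp_polyCurve_uncurry hg)).const_smul _

lemma differentiableAt_prolong {g : EuclideanSpace ℝ (Fin n) → F} {p : JetModel n k}
    (hg : ContDiffAt ℝ ∞ g (p 0)) (b : ℕ) : DifferentiableAt ℝ (prolong (k := k) g b) p :=
  (contDiffAt_prolong hg b).differentiableAt (by simp)

@[simp] lemma prolong_zero (g : EuclideanSpace ℝ (Fin n) → F) (p : JetModel n k) :
    prolong g 0 p = g (p 0) := by
  simp [prolong, polyCurve_zero]

/-- For fixed `t` the polynomial curve is linear in its coefficients, hence its own derivative. -/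
lemma differentiableAt_and_fderiv_polyCurve (p v : JetModel n k) (t : ℝ) :
    DifferentiableAt ℝ (fun q : JetModel n k => polyCurve q t) p ∧
    fderiv ℝ (fun q : JetModel n k => polyCurve q t) p v = polyCurve v t := by
  let l : JetModel n k →L[ℝ] EuclideanSpace ℝ (Fin n) :=
    ∑ α : Fin (k + 1), t ^ (α : ℕ) • ContinuousLinearMap.proj α
  have hl : (fun q : JetModel n k => polyCurve q t) = l := by
    funext q
    simp [l, polyCurve]
  rw [hl]
  refine ⟨l.differentiableAt, ?_⟩
  rw [l.fderiv]
  exact congrFun hl.symm v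

lemma eventually_differentiableAt_polyCurve {g : EuclideanSpace ℝ (Fin n) → F} {p : JetModel n k}
    (hg : ContDiffAt ℝ ∞ g (p 0)) :
    ∀ᶠ t in nhds (0 : ℝ), DifferentiableAt ℝ g (polyCurve p t) := by
  have h1 : ContDiffAt ℝ 1 g (polyCurve p 0) := by
    rw [polyCurve_zero]
    exact hg.of_le (by exact_mod_cast le_top)
  have hc : ContinuousAt (polyCurve p) 0 := (contDiff_polyCurve p).continuous.continuousAt
  filter_upwards [hc.eventually (h1.eventually (by simp))] with t ht
  exact ht.differentiableAt (by simp)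

/-- The parameter derivative passes through the time derivatives, and by linearity the inner chain
rule sees only the curve `polyCurve v`. The coordinate vectors make this curve a monomial, Γ makes
it the velocity. -/
lemma fderiv_prolong {g : EuclideanSpace ℝ (Fin n) → F} {p : JetModel n k}
    (hg : ContDiffAt ℝ ∞ g (p 0)) (b : ℕ) (v : JetModel n k) :
    fderiv ℝ (prolong g b) p v = (b.factorial : ℝ)⁻¹ •
      iteratedDeriv b (fun t => fderiv ℝ g (polyCurve p t) (polyCurve v t)) 0 := by
  have hH := contDiffAt_comp_polyCurve_uncurry hg
  have hd := (contDiffAt_iteratedDeriv_param b hH).differentiableAt (by simp)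
  unfold prolong
  rw [fderiv_fun_const_smul hd]
  simp only [_root_.smul_apply]
  rw [fderiv_iteratedDeriv_comm b hH]
  congr 1
  refine Filter.EventuallyEq.iteratedDeriv_eq b ?_
  filter_upwards [eventually_differentiableAt_polyCurve hg] with t ht
  have := fderiv_comp p (g := g) (f := fun q : JetModel n k => polyCurve q t) ht
    (differentiableAt_and_fderiv_polyCurve p v t).1
  have e : (fun q : JetModel n k => g (polyCurve q t)) = g ∘ fun q => polyCurve q t := rfl
  rw [e, this, ContinuousLinearMap.comp_apply, (differentiableAt_and_fderiv_polyCurve p v t).2]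

lemma contDiffAt_fderiv_apply {g : EuclideanSpace ℝ (Fin n) → F} {x : EuclideanSpace ℝ (Fin n)}
    (hg : ContDiffAt ℝ ∞ g x) (e : EuclideanSpace ℝ (Fin n)) :
    ContDiffAt ℝ ∞ (fun y => fderiv ℝ g y e) x :=
  (hg.fderiv_right (m := ∞) (by simp)).clm_apply contDiffAt_const

lemma polyCurve_basisVec {a : ℕ} (ha : a ≤ k) (j : Fin n) (t : ℝ) :
    polyCurve (basisVec (k := k) a j) t = t ^ a • EuclideanSpace.single j (1 : ℝ) := by
  unfold polyCurve basisVec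
  rw [Finset.sum_eq_single (⟨a, Nat.lt_succ_of_le ha⟩ : Fin (k + 1))]
  · simp
  · intro b _ hb
    have : (b : ℕ) ≠ a := fun h => hb (Fin.ext h)
    simp [this]
  · simp

/-- The derivatives of a Taylor coefficient along the coordinate directions. -/
lemma fderiv_prolong_basisVec {g : EuclideanSpace ℝ (Fin n) → F} {p : JetModel n k}
    (hg : ContDiffAt ℝ ∞ g (p 0)) (b : ℕ) {a : ℕ} (ha : a ≤ k) (j : Fin n) :
    fderiv ℝ (prolong g b) p (basisVec a j) =
      if a ≤ b then prolong (fun y => fderiv ℝ g y (EuclideanSpace.single j 1)) (b - a) p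
      else 0 := by
  rw [fderiv_prolong hg]
  simp only [polyCurve_basisVec ha, map_smul]
  rw [iteratedDeriv_pow_smul (contDiffAt_comp_polyCurve (contDiffAt_fderiv_apply hg _))]
  rfl

/-- Termwise differentiation: the components `(α + 1) y^(α+1)` of Γ are the coefficients of the
velocity. Hence Γ is the total time derivative. -/
lemma polyCurve_gammaField (p : JetModel n k) (t : ℝ) :
    polyCurve (gammaField p) t = deriv (polyCurve p) t := by
  have h : polyCurve p = fun t : ℝ => ∑ β : Fin (k + 1), t ^ (β : ℕ) • p β := rfl
  rw [h, deriv_fun_sum (fun i _ => by fun_prop)]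
  have e : ∀ β : Fin (k + 1), deriv (fun t : ℝ => t ^ (β : ℕ) • p β) t =
      ((β : ℕ) * t ^ ((β : ℕ) - 1)) • p β := fun β => by
    rw [deriv_smul_const (by fun_prop)]
    simp
  simp only [e]
  rw [Fin.sum_univ_succ]
  unfold polyCurve gammaField
  rw [Fin.sum_univ_castSucc]
  simp only [Fin.snoc_castSucc, Fin.snoc_last, smul_zero, add_zero, Fin.val_castSucc, Fin.val_zero,
    Nat.cast_zero, zero_mul, zero_smul, zero_add, Fin.val_succ, smul_smul]
  refine Finset.sum_congr rfl fun i _ => ?_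
  congr 1
  push_cast
  simp [mul_comm]

/-- The operator `Γ` shifts the Taylor coefficients. -/
lemma fderiv_prolong_gammaField {g : EuclideanSpace ℝ (Fin n) → F} {p : JetModel n k}
    (hg : ContDiffAt ℝ ∞ g (p 0)) (b : ℕ) :
    fderiv ℝ (prolong g b) p (gammaField p) = ((b : ℝ) + 1) • prolong g (b + 1) p := by
  rw [fderiv_prolong hg]
  unfold prolong
  rw [iteratedDeriv_succ', smul_smul]
  have e : iteratedDeriv b (fun t => fderiv ℝ g (polyCurve p t) (polyCurve (gammaField p) t)) 0 =
      iteratedDeriv b (deriv fun t => g (polyCurve p t)) 0 := by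
    refine Filter.EventuallyEq.iteratedDeriv_eq b ?_
    filter_upwards [eventually_differentiableAt_polyCurve hg] with t ht
    rw [polyCurve_gammaField]
    exact (fderiv_comp_deriv t ht
      ((contDiff_polyCurve p).differentiable (by simp)).differentiableAt).symm
  rw [e]
  congr 1
  rw [Nat.factorial_succ]
  push_cast
  field_simp

lemma gammaField_apply (p : JetModel n k) {a : ℕ} (ha : a < k) :
    gammaField p ⟨a, by omega⟩ = ((a : ℝ) + 1) • p ⟨a + 1, by omega⟩ :=
  Fin.snoc_castSucc (α := fun _ => EuclideanSpace ℝ (Fin n)) _ _ (⟨a, ha⟩ : Fin k)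

lemma semisprayField_apply (G : Fin n → JetModel n k → ℝ) (p : JetModel n k) {a : ℕ} (ha : a < k) :
    semisprayField G p ⟨a, by omega⟩ = ((a : ℝ) + 1) • p ⟨a + 1, by omega⟩ :=
  Fin.snoc_castSucc (α := fun _ => EuclideanSpace ℝ (Fin n)) _ _ (⟨a, ha⟩ : Fin k)

lemma semisprayField_last (G : Fin n → JetModel n k → ℝ) (p : JetModel n k) :
    semisprayField G p (Fin.last k) = WithLp.toLp 2 fun i => -(((k : ℝ) + 1) * G i p) :=
  Fin.snoc_last (α := fun _ => EuclideanSpace ℝ (Fin n)) _ _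

lemma basisVec_apply (a : ℕ) (j : Fin n) (β : Fin (k + 1)) (i : Fin n) :
    (basisVec a j : JetModel n k) β i = if (β : ℕ) = a ∧ i = j then 1 else 0 := by
  unfold basisVec
  split_ifs with h1 h2 h2
  · simp [h2.2]
  · have : i ≠ j := fun h => h2 ⟨h1, h⟩
    simp [this]
  · exact absurd h2.1 h1
  · simp

/-- This isolates the difference from Γ, which lies along the `∂/∂y^(k)j` only; on functions of
order below `k` the two fields agree. -/
lemma semisprayField_eq (G : Fin n → JetModel n k → ℝ) (p : JetModel n k) :
    semisprayField G p = gammaField p - ((k : ℝ) + 1) • ∑ j, G j p • basisVec k j := by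
  ext α i
  refine Fin.lastCases ?_ (fun a => ?_) α
  · rw [semisprayField_last]
    simp [gammaField, basisVec_apply, Finset.sum_apply]
  · simp [semisprayField, gammaField, basisVec_apply, Finset.sum_apply, a.2.ne]

lemma eq_sum_basisVec (v : JetModel n k) :
    v = ∑ α : Fin (k + 1), ∑ j, v α j • basisVec (α : ℕ) j := by
  ext β i
  simp only [Finset.sum_apply, Pi.smul_apply, WithLp.ofLp_sum, WithLp.ofLp_smul, smul_eq_mul,
    basisVec_apply]
  rw [Finset.sum_eq_single β, Finset.sum_eq_single i]
  · simp
  · intro j _ hj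
    simp [hj.symm]
  · simp
  · intro a _ ha
    have : (β : ℕ) ≠ a := fun h => ha (Fin.ext h.symm)
    simp [this]
  · simp

/-- A Taylor coefficient of order `b < k` does not depend on `y^(k)`, so the correction to Γ is
invisible. -/
lemma fderiv_prolong_semisprayField {g : EuclideanSpace ℝ (Fin n) → F} {p : JetModel n k}
    (hg : ContDiffAt ℝ ∞ g (p 0)) {b : ℕ} (hb : b < k) (G : Fin n → JetModel n k → ℝ) :
    fderiv ℝ (prolong g b) p (semisprayField G p) = ((b : ℝ) + 1) • prolong g (b + 1) p := by
  rw [semisprayField_eq, map_sub, fderiv_prolong_gammaField hg, map_smul, map_sum]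
  simp [fderiv_prolong_basisVec hg b le_rfl, not_le.2 hb]

/-- At the top order the correction enters through the Jacobian of `g` at the base point. The
coefficient of order `k + 1` is still a function of `p`, being computed on a polynomial curve of
degree at most `k`. -/
lemma fderiv_prolong_semisprayField_last {g : EuclideanSpace ℝ (Fin n) → F} {p : JetModel n k}
    (hg : ContDiffAt ℝ ∞ g (p 0)) (G : Fin n → JetModel n k → ℝ) :
    fderiv ℝ (prolong g k) p (semisprayField G p) = ((k : ℝ) + 1) • (prolong g (k + 1) p -
      ∑ j, G j p • fderiv ℝ g (p 0) (EuclideanSpace.single j 1)) := by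
  rw [semisprayField_eq, map_sub, fderiv_prolong_gammaField hg, map_smul, map_sum, smul_sub]
  simp [fderiv_prolong_basisVec hg k le_rfl]

end Prolongation

/-! ### Changes of coordinates and the convolution form of the dual-coefficient law. -/

section Transitions

open Finset.HasAntidiagonal (antidiagonal mem_antidiagonal)

variable {n k : ℕ}

/-- The map of jets induced by a map of the base. -/
def jetMap (k : ℕ) (τ : EuclideanSpace ℝ (Fin n) → EuclideanSpace ℝ (Fin n)) (p : JetModel n k) :
    JetModel n k :=
  fun α => prolong τ α p

/-- The Taylor coefficients of the Jacobian matrix of `τ` along the polynomial curve of `p`; these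
are the blocks of the Jacobian matrix of `jetMap k τ`. -/
def coordMat (τ : EuclideanSpace ℝ (Fin n) → EuclideanSpace ℝ (Fin n)) (b : ℕ) (p : JetModel n k) :
    Matrix (Fin n) (Fin n) ℝ :=
  Matrix.of fun i j => prolong (fun y => fderiv ℝ τ y (EuclideanSpace.single j 1)) b p i

variable {τ : EuclideanSpace ℝ (Fin n) → EuclideanSpace ℝ (Fin n)} {p : JetModel n k}

lemma contDiffAt_jetMap (hτ : ContDiffAt ℝ ∞ τ (p 0)) : ContDiffAt ℝ ∞ (jetMap k τ) p :=
  contDiffAt_pi.2 fun α => contDiffAt_prolong hτ α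

lemma differentiableAt_jetMap (hτ : ContDiffAt ℝ ∞ τ (p 0)) : DifferentiableAt ℝ (jetMap k τ) p :=
  (contDiffAt_jetMap hτ).differentiableAt (by simp)

lemma fderiv_jetMap_apply (hτ : ContDiffAt ℝ ∞ τ (p 0)) (v : JetModel n k) (α : Fin (k + 1)) :
    fderiv ℝ (jetMap k τ) p v α = fderiv ℝ (prolong τ α) p v := by
  have h : HasFDerivAt (jetMap k τ) (ContinuousLinearMap.pi fun α : Fin (k + 1) =>
      fderiv ℝ (prolong τ α) p) p :=
    hasFDerivAt_pi.2 fun α => (differentiableAt_prolong hτ α).hasFDerivAt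
  rw [h.fderiv]
  rfl

lemma fderiv_ofLp_apply {P : Type*} [NormedAddCommGroup P] [NormedSpace ℝ P]
    {f : P → EuclideanSpace ℝ (Fin n)} {x : P} (hf : DifferentiableAt ℝ f x) (i : Fin n) (v : P) :
    fderiv ℝ (fun y => f y i) x v = fderiv ℝ f x v i := by
  have h : HasFDerivAt (fun y => f y i) _ x :=
    (EuclideanSpace.proj (𝕜 := ℝ) i).hasFDerivAt.comp x hf.hasFDerivAt
  rw [h.fderiv]
  rfl

/-- Moving `y^(a)j` perturbs the curve by a multiple of `t ^ a`, so the Jacobian matrix is block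
lower triangular and its blocks depend only on the difference of the orders. -/
lemma fderiv_jetMap_basisVec (hτ : ContDiffAt ℝ ∞ τ (p 0)) {a : ℕ} (ha : a ≤ k) (j : Fin n)
    (α : Fin (k + 1)) (i : Fin n) :
    fderiv ℝ (jetMap k τ) p (basisVec a j) α i =
      if a ≤ (α : ℕ) then coordMat τ (α - a) p i j else 0 := by
  rw [fderiv_jetMap_apply hτ, fderiv_prolong_basisVec hτ _ ha]
  split_ifs <;> simp [coordMat]

lemma contDiffAt_coordMat (hτ : ContDiffAt ℝ ∞ τ (p 0)) (b : ℕ) (i j : Fin n) :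
    ContDiffAt ℝ ∞ (fun q : JetModel n k => coordMat τ b q i j) p :=
  (EuclideanSpace.proj (𝕜 := ℝ) i).contDiff.contDiffAt.comp p
    (contDiffAt_prolong (contDiffAt_fderiv_apply hτ _) b)

lemma differentiableAt_coordMat (hτ : ContDiffAt ℝ ∞ τ (p 0)) (b : ℕ) (i j : Fin n) :
    DifferentiableAt ℝ (fun q : JetModel n k => coordMat τ b q i j) p :=
  (contDiffAt_coordMat hτ b i j).differentiableAt (by simp)

/-- The columns of `coordMat` are Taylor coefficients of the partial derivatives of τ, and `S`
shifts Taylor coefficients below the top order. -/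
lemma fderiv_coordMat_semisprayField (hτ : ContDiffAt ℝ ∞ τ (p 0)) {b : ℕ} (hb : b < k)
    (G : Fin n → JetModel n k → ℝ) (i j : Fin n) :
    fderiv ℝ (fun q : JetModel n k => coordMat τ b q i j) p (semisprayField G p) =
      ((b : ℝ) + 1) * coordMat τ (b + 1) p i j := by
  have hσ := contDiffAt_fderiv_apply hτ (EuclideanSpace.single j 1)
  have := fderiv_ofLp_apply (differentiableAt_prolong (k := k) hσ b) i (semisprayField G p)
  rw [fderiv_prolong_semisprayField hσ hb] at this
  exact this

lemma fderiv_coordMat_zero_basisVec (hτ : ContDiffAt ℝ ∞ τ (p 0)) {a : ℕ} (ha : a ≤ k) (ha' : 0 < a)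
    (i j m : Fin n) :
    fderiv ℝ (fun q : JetModel n k => coordMat τ 0 q i j) p (basisVec a m) = 0 := by
  have hσ := contDiffAt_fderiv_apply hτ (EuclideanSpace.single j 1)
  have := fderiv_ofLp_apply (differentiableAt_prolong (k := k) hσ 0) i (basisVec a m)
  rw [fderiv_prolong_basisVec hσ 0 ha, if_neg (by omega)] at this
  exact this

/-- The coefficients in the new coordinates of the `k`-semispray with coefficients `G`. -/
lemma fderiv_jetMap_semisprayField (hτ : ContDiffAt ℝ ∞ τ (p 0)) (G : Fin n → JetModel n k → ℝ)
    (G' : Fin n → JetModel n k → ℝ) :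
    fderiv ℝ (jetMap k τ) p (semisprayField G p) = semisprayField G' (jetMap k τ p) ↔
      ∀ i, G' i (jetMap k τ p) = ∑ j, coordMat τ 0 p i j * G j p - prolong τ (k + 1) p i := by
  constructor
  -- Only the top component carries information; the lower ones match for any `G'`.
  · intro h i
    have h1 := congrArg (fun v : JetModel n k => v (Fin.last k) i) h
    simp only [fderiv_jetMap_apply hτ, Fin.val_last, fderiv_prolong_semisprayField_last hτ,
      semisprayField_last] at h1
    have hk : ((k : ℝ) + 1) ≠ 0 := by positivity
    have h2 : ((k : ℝ) + 1) * (G' i (jetMap k τ p)) = ((k : ℝ) + 1) *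
        (∑ j, coordMat τ 0 p i j * G j p - prolong τ (k + 1) p i) := by
      simp only [PiLp.smul_apply, PiLp.sub_apply, smul_eq_mul, WithLp.ofLp_sum,
        Finset.sum_apply, WithLp.ofLp_smul, Pi.smul_apply] at h1
      simp only [coordMat, Matrix.of_apply, prolong_zero]
      simp only [mul_comm (G _ p)] at h1
      linarith
    exact mul_left_cancel₀ hk h2
  · intro h
    ext α i
    refine Fin.lastCases ?_ (fun a => ?_) α
    · rw [fderiv_jetMap_apply hτ, Fin.val_last, fderiv_prolong_semisprayField_last hτ,
        semisprayField_last]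
      simp only [h, PiLp.smul_apply, PiLp.sub_apply, smul_eq_mul, WithLp.ofLp_sum,
        Finset.sum_apply, WithLp.ofLp_smul, Pi.smul_apply, coordMat, Matrix.of_apply, prolong_zero]
      simp only [mul_comm (G _ p)]
      ring
    · rw [fderiv_jetMap_apply hτ, Fin.val_castSucc, fderiv_prolong_semisprayField hτ a.2]
      have := semisprayField_apply G' (jetMap k τ p) a.2
      have e : a.castSucc = ⟨(a : ℕ), by omega⟩ := rfl
      rw [e, this]
      rfl

/-- The components of a tangent vector, extended by `0`. -/
def jetVec (v : JetModel n k) (b : ℕ) : Fin n → ℝ :=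
  if h : b < k + 1 then v ⟨b, h⟩ else 0

lemma jetVec_coe (v : JetModel n k) (α : Fin (k + 1)) : jetVec v α = v α := by
  exact dif_pos α.2

open Finset in
-- A block Toeplitz matrix acts on the sequence of components as a product of power series truncated
-- at order `k`.
lemma jetVec_fderiv_jetMap (hτ : ContDiffAt ℝ ∞ τ (p 0)) (v : JetModel n k) {a : ℕ} (ha : a ≤ k) :
    jetVec (fderiv ℝ (jetMap k τ) p v) a =
      ∑ x ∈ antidiagonal a, (coordMat τ x.1 p).mulVec (jetVec v x.2) := by
  have hv : fderiv ℝ (jetMap k τ) p v =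
      ∑ β : Fin (k + 1), ∑ j, jetVec v β j • fderiv ℝ (jetMap k τ) p (basisVec (β : ℕ) j) := by
    conv_lhs => rw [eq_sum_basisVec v]
    simp [map_sum, jetVec_coe]
  have h1 : ∀ i, fderiv ℝ (jetMap k τ) p v ⟨a, by omega⟩ i = ∑ β ∈ range (k + 1),
      if β ≤ a then ((coordMat τ (a - β) p).mulVec (jetVec v β)) i else 0 := by
    intro i
    rw [hv, ← Fin.sum_univ_eq_sum_range (fun β =>
      if β ≤ a then ((coordMat τ (a - β) p).mulVec (jetVec v β)) i else 0)]
    simp only [Finset.sum_apply, WithLp.ofLp_sum, Pi.smul_apply, WithLp.ofLp_smul, smul_eq_mul]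
    refine sum_congr rfl fun β _ => ?_
    simp only [fderiv_jetMap_basisVec hτ (Nat.lt_succ_iff.1 β.2)]
    split_ifs
    · simp [Matrix.mulVec, dotProduct, mul_comm]
    · simp
  funext i
  have : jetVec (fderiv ℝ (jetMap k τ) p v) a i = fderiv ℝ (jetMap k τ) p v ⟨a, by omega⟩ i := by
    simp [jetVec, Nat.lt_succ_of_le ha]
  rw [this, h1, ← sum_filter, ← Nat.sum_antidiagonal_swap,
    Nat.sum_antidiagonal_eq_sum_range_succ_mk, Finset.sum_apply]
  refine sum_congr ?_ fun β _ => rfl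
  ext β
  simp only [mem_filter, mem_range]
  omega

/-- The dual coefficients as matrices, completed by `M_(0) = 1`. -/
def fullCoeff (C : ℕ → Fin n → Fin n → JetModel n k → ℝ) (a : ℕ) (p : JetModel n k) :
    Matrix (Fin n) (Fin n) ℝ :=
  if a = 0 then 1 else Matrix.of fun i j => C a i j p

open Finset in
-- With `M_(0) = 1` the leading term `dy^(α)` joins the sum, and the form becomes the coefficient of
-- order `α` in the product of the series of `C` and of `v`.
lemma dualForm_eq (C : ℕ → Fin n → Fin n → JetModel n k → ℝ) (α : Fin (k + 1)) (i : Fin n)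
    (p v : JetModel n k) :
    dualForm C α i p v =
      (∑ x ∈ antidiagonal (α : ℕ), (fullCoeff C x.1 p).mulVec (jetVec v x.2)) i := by
  rw [← Nat.sum_antidiagonal_swap, Nat.sum_antidiagonal_eq_sum_range_succ_mk, sum_range_succ,
    Pi.add_apply, add_comm]
  unfold dualForm
  congr 1
  · simp [fullCoeff, jetVec_coe]
  · rw [Finset.sum_apply]
    refine sum_nbij' (fun β : Fin (k + 1) => (β : ℕ)) (fun b : ℕ => Fin.ofNat (k + 1) b)
      ?_ ?_ ?_ ?_ ?_
    · intro β hβ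
      simpa using hβ
    · intro b hb
      have h1 := mem_range.1 hb
      have h2 := α.2
      simp only [mem_Iio, Fin.lt_def, Fin.val_ofNat]
      rwa [Nat.mod_eq_of_lt (by omega)]
    · intro β _
      simp
    · intro b hb
      have h1 := mem_range.1 hb
      have h2 := α.2
      simp only [Fin.val_ofNat]
      exact Nat.mod_eq_of_lt (by omega)
    · intro β hβ
      have h : (β : ℕ) < α := by simpa using hβ
      have h0 : (α : ℕ) - β ≠ 0 := by omega
      simp [fullCoeff, jetVec_coe, Matrix.mulVec, dotProduct, h0]

/-- The transformation law of dual coefficients under a change of coordinates. -/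
def DualLaw (τ : EuclideanSpace ℝ (Fin n) → EuclideanSpace ℝ (Fin n))
    (C C' : ℕ → Fin n → Fin n → JetModel n k → ℝ) (p : JetModel n k) : Prop :=
  ∀ a ≤ k, ∑ x ∈ antidiagonal a,
    fullCoeff C' x.1 (jetMap k τ p) * coordMat τ x.2 p = coordMat τ 0 p * fullCoeff C a p

/-- Associativity of the Cauchy product, stated for an arbitrary summand of three indices. -/
lemma sum_antidiagonal_assoc {A : Type*} [AddCommMonoid A] (f : ℕ → ℕ → ℕ → A) (a : ℕ) :
    ∑ x ∈ antidiagonal a, ∑ y ∈ antidiagonal x.2, f x.1 y.1 y.2 =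
      ∑ x ∈ antidiagonal a, ∑ y ∈ antidiagonal x.1, f y.1 y.2 x.2 := by
  rw [Finset.sum_sigma', Finset.sum_sigma']
  refine Finset.sum_nbij' (fun z => ⟨(z.1.1 + z.2.1, z.2.2), (z.1.1, z.2.1)⟩)
    (fun z => ⟨(z.2.1, z.2.2 + z.1.2), (z.2.2, z.1.2)⟩) ?_ ?_ ?_ ?_ ?_
  all_goals
    simp only [Finset.mem_sigma, mem_antidiagonal]
    rintro ⟨⟨a, b⟩, ⟨c, d⟩⟩ ⟨h1, h2⟩
    simp only at h1 h2
    try subst h2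
    try simp
    try omega

/-- In series notation, `M' (A v) = (M' A) v = A₀ M v`. The forms of two charts thus differ by the
matrix `A₀`. -/
lemma DualLaw.dualForm_fderiv (hτ : ContDiffAt ℝ ∞ τ (p 0))
    {C C' : ℕ → Fin n → Fin n → JetModel n k → ℝ} (h : DualLaw τ C C' p) (v : JetModel n k)
    (α : Fin (k + 1)) (i : Fin n) :
    dualForm C' α i (jetMap k τ p) (fderiv ℝ (jetMap k τ) p v) =
      (coordMat τ 0 p).mulVec (fun j => dualForm C α j p v) i := by
  have hα := Nat.lt_succ_iff.1 α.2
  have e : (fun j => dualForm C α j p v) =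
      ∑ x ∈ antidiagonal (α : ℕ), (fullCoeff C x.1 p).mulVec (jetVec v x.2) :=
    funext fun j => dualForm_eq C α j p v
  rw [dualForm_eq, e]
  refine congrFun ?_ i
  rw [Matrix.mulVec_sum]
  have h1 : ∀ x ∈ antidiagonal (α : ℕ),
      (fullCoeff C' x.1 (jetMap k τ p)).mulVec (jetVec (fderiv ℝ (jetMap k τ) p v) x.2) =
      ∑ y ∈ antidiagonal x.2, (fullCoeff C' x.1 (jetMap k τ p) * coordMat τ y.1 p).mulVec
        (jetVec v y.2) := by
    intro x hx
    have := mem_antidiagonal.1 hx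
    rw [jetVec_fderiv_jetMap hτ v (by omega), Matrix.mulVec_sum]
    simp only [Matrix.mulVec_mulVec]
  rw [Finset.sum_congr rfl h1, sum_antidiagonal_assoc (fun a b c =>
    (fullCoeff C' a (jetMap k τ p) * coordMat τ b p).mulVec (jetVec v c))]
  refine Finset.sum_congr rfl fun x hx => ?_
  have := mem_antidiagonal.1 hx
  rw [← Matrix.sum_mulVec, h x.1 (by omega), Matrix.mulVec_mulVec]

end Transitions

/-! ### Transformation laws of Bucătaru's and Miron's coefficients. -/

section DualCoefficients

open Finset.HasAntidiagonal (antidiagonal mem_antidiagonal)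

variable {n k : ℕ}

lemma fderiv_comp_jetMap {τ : EuclideanSpace ℝ (Fin n) → EuclideanSpace ℝ (Fin n)}
    {p : JetModel n k} (hτ : ContDiffAt ℝ ∞ τ (p 0)) {f : JetModel n k → ℝ}
    (hf : DifferentiableAt ℝ f (jetMap k τ p)) (v : JetModel n k) :
    fderiv ℝ (fun q => f (jetMap k τ q)) p v =
      fderiv ℝ f (jetMap k τ p) (fderiv ℝ (jetMap k τ) p v) := by
  have := fderiv_comp p (g := f) (f := jetMap k τ) hf (differentiableAt_jetMap hτ)
  exact congrArg (fun l => l v) this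

lemma fderiv_apply_eq_sum (f : JetModel n k → ℝ) (p v : JetModel n k) :
    fderiv ℝ f p v = ∑ α : Fin (k + 1), ∑ j, v α j * pderivY (α : ℕ) j f p := by
  conv_lhs => rw [eq_sum_basisVec v]
  simp [map_sum, pderivY]

open Finset in
/-- The chain rule for partial derivatives under a change of coordinates. -/
lemma pderivY_comp_jetMap {τ : EuclideanSpace ℝ (Fin n) → EuclideanSpace ℝ (Fin n)}
    {p : JetModel n k} (hτ : ContDiffAt ℝ ∞ τ (p 0)) {f : JetModel n k → ℝ}
    (hf : DifferentiableAt ℝ f (jetMap k τ p)) {β d : ℕ} (hβ : β + d = k) (j : Fin n) :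
    pderivY β j (fun q => f (jetMap k τ q)) p = ∑ b ∈ range (d + 1),
      ∑ m, pderivY (β + b) m f (jetMap k τ p) * coordMat τ b p m j := by
  unfold pderivY
  rw [fderiv_comp_jetMap hτ hf, fderiv_apply_eq_sum]
  simp only [fderiv_jetMap_basisVec hτ (show β ≤ k by omega)]
  -- The new coordinates of order below `β` do not depend on `y^(β)`, so the sum effectively starts
  -- at `β`.
  rw [Fin.sum_univ_eq_sum_range (fun α => ∑ m : Fin n,
      (if β ≤ α then coordMat τ (α - β) p m j else 0) * pderivY α m f (jetMap k τ p)),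
    show range (k + 1) = range (β + (d + 1)) from congrArg range (by omega),
    sum_range_add]
  rw [sum_eq_zero, zero_add]
  · refine sum_congr rfl fun b _ => sum_congr rfl fun m _ => ?_
    simp [pderivY, mul_comm]
  · intro b hb
    have := mem_range.1 hb
    simp [not_le.2 this]

open Finset in
-- Differentiate the law of `G` in `y^(k+1-a)`. On the left the chain rule gives the terms `M'_(a-b)
-- A_b` with `b < a`. On the right `A₀` depends on `x` alone, and the inhomogeneous term of order `k
-- + 1` has derivative `A_a`, which is the missing term `M'_(0) A_a`.
lemma dualLaw_bucataruCoeff {τ : EuclideanSpace ℝ (Fin n) → EuclideanSpace ℝ (Fin n)}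
    {p : JetModel n k} (hτ : ContDiffAt ℝ ∞ τ (p 0)) {G G' : Fin n → JetModel n k → ℝ}
    (hG : ∀ i, DifferentiableAt ℝ (G i) p) (hG' : ∀ i, DifferentiableAt ℝ (G' i) (jetMap k τ p))
    (h : ∀ᶠ q in nhds p, ∀ i,
      G' i (jetMap k τ q) = ∑ j, coordMat τ 0 q i j * G j q - prolong τ (k + 1) q i) :
    DualLaw τ (bucataruCoeff G) (bucataruCoeff G') p := by
  intro a ha
  rcases Nat.eq_zero_or_pos a with rfl | ha0
  · simp [fullCoeff]
  ext i j
  have hβ : (k + 1 - a) + (a - 1) = k := by omega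
  have e1 := pderivY_comp_jetMap hτ (hG' i) hβ j
  have hev : (fun q => G' i (jetMap k τ q)) =ᶠ[nhds p]
      fun q => ∑ j, coordMat τ 0 q i j * G j q - prolong τ (k + 1) q i := h.mono fun q hq => hq i
  have hd1 : ∀ m, DifferentiableAt ℝ (fun q => coordMat τ 0 q i m * G m q) p := fun m =>
    (differentiableAt_coordMat hτ 0 i m).mul (hG m)
  have hd2 := differentiableAt_prolong (k := k) hτ (k + 1)
  have hd3 : DifferentiableAt ℝ (fun q : JetModel n k => prolong τ (k + 1) q i) p :=
    (EuclideanSpace.proj (𝕜 := ℝ) i).differentiableAt.comp p hd2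
  unfold pderivY at e1
  rw [hev.fderiv_eq, fderiv_fun_sub (DifferentiableAt.fun_sum fun m _ => hd1 m) hd3,
    fderiv_fun_sum (fun m _ => hd1 m), _root_.sub_apply, fderiv_ofLp_apply hd2,
    fderiv_prolong_basisVec hτ _ (by omega), if_pos (by omega)] at e1
  have e2 : ∀ m, fderiv ℝ (fun q => coordMat τ 0 q i m * G m q) p (basisVec (k + 1 - a) j) =
      coordMat τ 0 p i m * pderivY (k + 1 - a) j (G m) p := fun m => by
    rw [fderiv_fun_mul (differentiableAt_coordMat hτ 0 i m) (hG m), _root_.add_apply,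
      _root_.smul_apply, _root_.smul_apply,
      fderiv_coordMat_zero_basisVec hτ (by omega) (by omega), smul_zero, add_zero]
    rfl
  simp only [_root_.sum_apply, e2] at e1
  have e3 : prolong (fun y => fderiv ℝ τ y (EuclideanSpace.single j 1)) (k + 1 - (k + 1 - a)) p i =
      coordMat τ a p i j := by
    rw [show k + 1 - (k + 1 - a) = a by omega]
    rfl
  rw [e3, show a - 1 + 1 = a by omega, sub_eq_iff_eq_add] at e1
  rw [← Nat.sum_antidiagonal_swap, Nat.sum_antidiagonal_eq_sum_range_succ_mk, sum_range_succ]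
  simp only [Prod.swap, Nat.sub_self]
  rw [Matrix.add_apply, Matrix.sum_apply]
  have e4 : (fullCoeff (bucataruCoeff G') 0 (jetMap k τ p) * coordMat τ a p) i j =
      coordMat τ a p i j := by simp [fullCoeff]
  have e5 : (coordMat τ 0 p * fullCoeff (bucataruCoeff G) a p) i j =
      ∑ m, coordMat τ 0 p i m * pderivY (k + 1 - a) j (G m) p := by
    simp [fullCoeff, ha0.ne', Matrix.mul_apply, bucataruCoeff]
  rw [e4, e5, e1]
  congr 1
  refine sum_congr rfl fun b hb => ?_
  have hb' := mem_range.1 hb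
  have h0 : a - b ≠ 0 := by omega
  simp only [Matrix.mul_apply, fullCoeff, if_neg h0, Matrix.of_apply, bucataruCoeff]
  rw [show k + 1 - (a - b) = k + 1 - a + b by omega]
  rfl

/-- The entrywise derivative of a matrix-valued function along a vector. -/
def matDeriv (A : JetModel n k → Matrix (Fin n) (Fin n) ℝ) (p v : JetModel n k) :
    Matrix (Fin n) (Fin n) ℝ :=
  Matrix.of fun i j => fderiv ℝ (fun q => A q i j) p v

lemma matDeriv_mul {A B : JetModel n k → Matrix (Fin n) (Fin n) ℝ} {p : JetModel n k}
    (hA : ∀ i j, DifferentiableAt ℝ (fun q => A q i j) p)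
    (hB : ∀ i j, DifferentiableAt ℝ (fun q => B q i j) p) (v : JetModel n k) :
    matDeriv (fun q => A q * B q) p v = matDeriv A p v * B p + A p * matDeriv B p v := by
  ext i j
  simp only [matDeriv, Matrix.of_apply, Matrix.add_apply, Matrix.mul_apply]
  rw [fderiv_fun_sum (A := fun m q => A q i m * B q m j) (fun m _ => (hA i m).mul (hB m j)),
    _root_.sum_apply,
    ← Finset.sum_add_distrib]
  refine Finset.sum_congr rfl fun m _ => ?_
  rw [fderiv_fun_mul (hA i m) (hB m j)]
  simp only [_root_.add_apply, _root_.smul_apply, smul_eq_mul]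
  ring

lemma differentiableAt_mul_apply {A B : JetModel n k → Matrix (Fin n) (Fin n) ℝ} {p : JetModel n k}
    (hA : ∀ i j, DifferentiableAt ℝ (fun q => A q i j) p)
    (hB : ∀ i j, DifferentiableAt ℝ (fun q => B q i j) p) (i j : Fin n) :
    DifferentiableAt ℝ (fun q => (A q * B q) i j) p := by
  simp only [Matrix.mul_apply]
  exact DifferentiableAt.fun_sum fun m _ => (hA i m).mul (hB m j)

lemma matDeriv_sum {ι : Type*} (s : Finset ι) {A : ι → JetModel n k → Matrix (Fin n) (Fin n) ℝ}
    {p : JetModel n k} (hA : ∀ x ∈ s, ∀ i j, DifferentiableAt ℝ (fun q => A x q i j) p)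
    (v : JetModel n k) :
    matDeriv (fun q => ∑ x ∈ s, A x q) p v = ∑ x ∈ s, matDeriv (A x) p v := by
  ext i j
  simp only [matDeriv, Matrix.of_apply, Matrix.sum_apply]
  rw [fderiv_fun_sum (fun x hx => hA x hx i j), _root_.sum_apply]

lemma matDeriv_congr {A B : JetModel n k → Matrix (Fin n) (Fin n) ℝ} {p : JetModel n k}
    (h : A =ᶠ[nhds p] B) (v : JetModel n k) : matDeriv A p v = matDeriv B p v := by
  ext i j
  have : (fun q => A q i j) =ᶠ[nhds p] fun q => B q i j := h.mono fun q hq => by simp only [hq]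
  simp only [matDeriv, Matrix.of_apply, this.fderiv_eq]

/-- The convention `M_(0) = 1` makes the recursion uniform in `a`: its case `a = 0` is trivial,
since the identity matrix has zero derivative. -/
lemma fullCoeff_mironCoeff_succ (G : Fin n → JetModel n k → ℝ) (a : ℕ) (p : JetModel n k) :
    ((a : ℝ) + 1) • fullCoeff (mironCoeff G) (a + 1) p =
      matDeriv (fullCoeff (mironCoeff G) a) p (semisprayField G p) +
        fullCoeff (mironCoeff G) 1 p * fullCoeff (mironCoeff G) a p := by
  cases a with
  | zero =>
    ext i j
    simp [fullCoeff, matDeriv]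
  | succ a =>
    ext i j
    have h : ((a : ℝ) + 2) ≠ 0 := by positivity
    simp only [fullCoeff, matDeriv, Matrix.add_apply, Matrix.smul_apply, Matrix.mul_apply,
      Matrix.of_apply, mironCoeff, if_neg (Nat.succ_ne_zero _), smul_eq_mul]
    rw [dualRecursion]
    simp only [derivAlong, dualRecursion]
    push_cast
    field_simp
    ring

/-- The product rule `(f g)' = f' g + f g'` for power series, read off in order `a`. -/
lemma sum_antidiagonal_smul {V : Type*} [AddCommGroup V] [Module ℝ V] (f : ℕ → ℕ → V) (a : ℕ) :
    ∑ x ∈ antidiagonal a, (((x.1 : ℝ) + 1) • f (x.1 + 1) x.2 + ((x.2 : ℝ) + 1) • f x.1 (x.2 + 1)) =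
      ((a : ℝ) + 1) • ∑ x ∈ antidiagonal (a + 1), f x.1 x.2 := by
  have h1 := Finset.Nat.sum_antidiagonal_succ (n := a) (f := fun x => (x.1 : ℝ) • f x.1 x.2)
  have h2 := Finset.Nat.sum_antidiagonal_succ' (n := a) (f := fun x => (x.2 : ℝ) • f x.1 x.2)
  simp only [Nat.cast_zero, zero_smul, zero_add, Nat.cast_add, Nat.cast_one] at h1 h2
  rw [Finset.sum_add_distrib, ← h1, ← h2, ← Finset.sum_add_distrib, Finset.smul_sum]
  refine Finset.sum_congr rfl fun x hx => ?_
  have : x.1 + x.2 = a + 1 := mem_antidiagonal.1 hx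
  rw [← add_smul]
  congr 1
  exact_mod_cast this

lemma contDiffOn_derivAlong {U : Set (JetModel n k)} (hU : IsOpen U)
    {X : JetModel n k → JetModel n k} {f : JetModel n k → ℝ} (hX : ContDiffOn ℝ ∞ X U)
    (hf : ContDiffOn ℝ ∞ f U) : ContDiffOn ℝ ∞ (derivAlong X f) U :=
  (hf.fderiv_of_isOpen hU (m := ∞) (by simp)).clm_apply hX

lemma contDiffOn_pderivY {U : Set (JetModel n k)} (hU : IsOpen U) {f : JetModel n k → ℝ}
    (hf : ContDiffOn ℝ ∞ f U) (a : ℕ) (j : Fin n) : ContDiffOn ℝ ∞ (pderivY a j f) U :=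
  contDiffOn_derivAlong hU (X := fun _ => basisVec a j) contDiffOn_const hf

lemma contDiff_gammaField : ContDiff ℝ ∞ (gammaField (n := n) (k := k)) := by
  refine contDiff_pi.2 fun α => ?_
  refine Fin.lastCases ?_ (fun a => ?_) α
  · simp only [gammaField, Fin.snoc_last]
    exact contDiff_const
  · simp only [gammaField, Fin.snoc_castSucc]
    fun_prop

lemma contDiffOn_semisprayField {U : Set (JetModel n k)} {G : Fin n → JetModel n k → ℝ}
    (hG : ∀ i, ContDiffOn ℝ ∞ (G i) U) : ContDiffOn ℝ ∞ (semisprayField G) U := by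
  have : semisprayField G = fun p => gammaField p - ((k : ℝ) + 1) • ∑ j, G j p • basisVec k j :=
    funext (semisprayField_eq G)
  rw [this]
  exact contDiff_gammaField.contDiffOn.sub
    ((ContDiffOn.sum fun j _ => (hG j).smul contDiffOn_const).const_smul _)

lemma contDiffOn_dualRecursion {U : Set (JetModel n k)} (hU : IsOpen U)
    {G : Fin n → JetModel n k → ℝ} (hG : ∀ i, ContDiffOn ℝ ∞ (G i) U)
    {M₁ : Fin n → Fin n → JetModel n k → ℝ} (hM : ∀ i j, ContDiffOn ℝ ∞ (M₁ i j) U) (a : ℕ) :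
    ∀ i j, ContDiffOn ℝ ∞ (dualRecursion G M₁ a i j) U := by
  induction a using Nat.twoStepInduction with
  | zero => exact fun _ _ => contDiffOn_const
  | one => exact hM
  | more a _ ih =>
    intro i j
    exact contDiffOn_const.mul ((contDiffOn_derivAlong hU (contDiffOn_semisprayField hG)
      (ih i j)).add (ContDiffOn.sum fun m _ => (hM i m).mul (ih m j)))

lemma contDiffOn_mironCoeff {U : Set (JetModel n k)} (hU : IsOpen U)
    {G : Fin n → JetModel n k → ℝ} (hG : ∀ i, ContDiffOn ℝ ∞ (G i) U) (a : ℕ) (i j : Fin n) :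
    ContDiffOn ℝ ∞ (mironCoeff G a i j) U :=
  contDiffOn_dualRecursion hU hG (fun i j => contDiffOn_pderivY hU (hG i) k j) a i j

lemma contDiffOn_bucataruCoeff {U : Set (JetModel n k)} (hU : IsOpen U)
    {G : Fin n → JetModel n k → ℝ} (hG : ∀ i, ContDiffOn ℝ ∞ (G i) U) (a : ℕ) (i j : Fin n) :
    ContDiffOn ℝ ∞ (bucataruCoeff G a i j) U :=
  contDiffOn_pderivY hU (hG i) _ j

lemma contDiffOn_fullCoeff {U : Set (JetModel n k)} {C : ℕ → Fin n → Fin n → JetModel n k → ℝ}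
    (hC : ∀ a i j, ContDiffOn ℝ ∞ (C a i j) U) (a : ℕ) (i j : Fin n) :
    ContDiffOn ℝ ∞ (fun p => fullCoeff C a p i j) U := by
  unfold fullCoeff
  split_ifs
  · exact contDiffOn_const
  · exact hC a i j

/-- The recursion differentiates, so agreement has to hold on an open set to propagate. -/
lemma dualRecursion_congr {U : Set (JetModel n k)} (hU : IsOpen U)
    {G G' : Fin n → JetModel n k → ℝ} (hG : ∀ i, Set.EqOn (G i) (G' i) U)
    {M₁ M₁' : Fin n → Fin n → JetModel n k → ℝ} (hM : ∀ i j, Set.EqOn (M₁ i j) (M₁' i j) U)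
    (a : ℕ) : ∀ i j, Set.EqOn (dualRecursion G M₁ a i j) (dualRecursion G' M₁' a i j) U := by
  induction a using Nat.twoStepInduction with
  | zero => exact fun _ _ _ _ => rfl
  | one => exact hM
  | more a _ ih =>
    intro i j p hp
    have h1 : semisprayField G p = semisprayField G' p := by
      rw [semisprayField_eq, semisprayField_eq]
      simp only [hG _ hp]
    have h2 : dualRecursion G M₁ (a + 1) i j =ᶠ[nhds p] dualRecursion G' M₁' (a + 1) i j :=
      (ih i j).eventuallyEq_of_mem (hU.mem_nhds hp)
    simp only [dualRecursion, derivAlong, h1, h2.fderiv_eq, hM _ _ hp, ih _ _ hp]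

lemma pderivY_congr {U : Set (JetModel n k)} (hU : IsOpen U) {f g : JetModel n k → ℝ}
    (h : Set.EqOn f g U) (a : ℕ) (j : Fin n) : Set.EqOn (pderivY a j f) (pderivY a j g) U := by
  intro p hp
  have := h.eventuallyEq_of_mem (hU.mem_nhds hp)
  simp only [pderivY, this.fderiv_eq]

/-- Differentiate the law of order `a` along `S`. As `S A_b = (b+1) A_(b+1)` and `S' M'_b = (b+1)
M'_(b+1) - M'_1 M'_b`, the left side becomes `a + 1` times the left side of order `a + 1`, minus
`M'_1 A₀ M_a`. By the law of order one the right side becomes `(a+1) A₀ M_(a+1)` minus the same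
term. -/
lemma dualLaw_mironCoeff {τ : EuclideanSpace ℝ (Fin n) → EuclideanSpace ℝ (Fin n)}
    (hk : 1 ≤ k) {U U' : Set (JetModel n k)} (hU : IsOpen U) (hU' : IsOpen U')
    (hτ : ∀ p ∈ U, ContDiffAt ℝ ∞ τ (p 0)) (hmaps : ∀ p ∈ U, jetMap k τ p ∈ U')
    {G G' : Fin n → JetModel n k → ℝ} (hG : ∀ i, ContDiffOn ℝ ∞ (G i) U)
    (hG' : ∀ i, ContDiffOn ℝ ∞ (G' i) U')
    (h : ∀ p ∈ U, ∀ i,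
      G' i (jetMap k τ p) = ∑ j, coordMat τ 0 p i j * G j p - prolong τ (k + 1) p i)
    {p : JetModel n k} (hp : p ∈ U) : DualLaw τ (mironCoeff G) (mironCoeff G') p := by
  intro a ha
  induction a generalizing p with
  | zero => simp [fullCoeff]
  | succ a ih =>
    have hak : a < k := by omega
    have hd : ∀ b i j, ∀ q ∈ U, DifferentiableAt ℝ (fun q => fullCoeff (mironCoeff G) b q i j) q :=
      fun b i j q hq => ((contDiffOn_fullCoeff (contDiffOn_mironCoeff hU hG) b i j).contDiffAt
        (hU.mem_nhds hq)).differentiableAt (by simp)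
    have hd' : ∀ b i j, ∀ q ∈ U',
        DifferentiableAt ℝ (fun q => fullCoeff (mironCoeff G') b q i j) q :=
      fun b i j q hq => ((contDiffOn_fullCoeff (contDiffOn_mironCoeff hU' hG') b i j).contDiffAt
        (hU'.mem_nhds hq)).differentiableAt (by simp)
    have hdA : ∀ b i j, DifferentiableAt ℝ (fun q : JetModel n k => coordMat τ b q i j) p :=
      fun b i j => differentiableAt_coordMat (hτ p hp) b i j
    have hdT : ∀ b i j,
        DifferentiableAt ℝ (fun q => fullCoeff (mironCoeff G') b (jetMap k τ q) i j) p :=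
      fun b i j => (hd' b i j _ (hmaps p hp)).comp p (differentiableAt_jetMap (hτ p hp))
    -- In order one the two families of coefficients coincide, so Bucătaru's law applies.
    have law1 : fullCoeff (mironCoeff G') 1 (jetMap k τ p) * coordMat τ 0 p + coordMat τ 1 p =
        coordMat τ 0 p * fullCoeff (mironCoeff G) 1 p := by
      have h1 := dualLaw_bucataruCoeff (hτ p hp)
        (fun i => ((hG i).contDiffAt (hU.mem_nhds hp)).differentiableAt (by simp))
        (fun i => ((hG' i).contDiffAt (hU'.mem_nhds (hmaps p hp))).differentiableAt (by simp))
        ((hU.eventually_mem hp).mono h) 1 hk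
      have e : ∀ (G : Fin n → JetModel n k → ℝ) q, fullCoeff (bucataruCoeff G) 1 q =
          fullCoeff (mironCoeff G) 1 q := fun G q => by
        simp [fullCoeff, bucataruCoeff, mironCoeff, dualRecursion]
      rw [Finset.Nat.sum_antidiagonal_succ] at h1
      simp only [Finset.Nat.antidiagonal_zero, Finset.sum_singleton, zero_add, e] at h1
      rw [← h1, add_comm]
      simp [fullCoeff]
    have hS : fderiv ℝ (jetMap k τ) p (semisprayField G p) = semisprayField G' (jetMap k τ p) :=
      (fderiv_jetMap_semisprayField (hτ p hp) G G').2 (h p hp)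
    have hDA : ∀ b < k, matDeriv (coordMat τ b) p (semisprayField G p) =
        ((b : ℝ) + 1) • coordMat τ (b + 1) p := fun b hb => by
      ext i j
      exact fderiv_coordMat_semisprayField (hτ p hp) hb G i j
    have hDT : ∀ b, matDeriv (fun q => fullCoeff (mironCoeff G') b (jetMap k τ q)) p
        (semisprayField G p) = matDeriv (fullCoeff (mironCoeff G') b) (jetMap k τ p)
          (semisprayField G' (jetMap k τ p)) := fun b => by
      ext i j
      rw [← hS]
      exact fderiv_comp_jetMap (hτ p hp) (hd' b i j _ (hmaps p hp)) _
    -- The induction hypothesis holds on all of `U`, so it may be differentiated at `p`.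
    have hcongr := matDeriv_congr (p := p)
      (A := fun q => ∑ x ∈ antidiagonal a,
        fullCoeff (mironCoeff G') x.1 (jetMap k τ q) * coordMat τ x.2 q)
      (B := fun q => coordMat τ 0 q * fullCoeff (mironCoeff G) a q)
      (by filter_upwards [hU.mem_nhds hp] with q hq using ih hq (by omega)) (semisprayField G p)
    rw [matDeriv_mul (hdA 0) (fun i j => hd a i j p hp), hDA 0 (by omega),
      matDeriv_sum _ (fun x _ => differentiableAt_mul_apply (hdT x.1) (hdA x.2))] at hcongr
    have hterm : ∀ x ∈ antidiagonal a,
        matDeriv (fun q => fullCoeff (mironCoeff G') x.1 (jetMap k τ q) * coordMat τ x.2 q) p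
          (semisprayField G p) =
        (((x.1 : ℝ) + 1) • (fullCoeff (mironCoeff G') (x.1 + 1) (jetMap k τ p) * coordMat τ x.2 p) +
        ((x.2 : ℝ) + 1) • (fullCoeff (mironCoeff G') x.1 (jetMap k τ p) * coordMat τ (x.2 + 1) p)) -
        fullCoeff (mironCoeff G') 1 (jetMap k τ p) *
          (fullCoeff (mironCoeff G') x.1 (jetMap k τ p) * coordMat τ x.2 p) := fun x hx => by
      have hx' : x.1 + x.2 = a := mem_antidiagonal.1 hx
      rw [matDeriv_mul (hdT x.1) (hdA x.2), hDA x.2 (by omega), hDT, ← Matrix.smul_mul,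
        fullCoeff_mironCoeff_succ, Matrix.mul_smul]
      noncomm_ring
    rw [Finset.sum_congr rfl hterm, Finset.sum_sub_distrib, ← Finset.mul_sum, ih hp (by omega),
      sum_antidiagonal_smul (fun b c =>
        fullCoeff (mironCoeff G') b (jetMap k τ p) * coordMat τ c p)] at hcongr
    have hfin : ((a : ℝ) + 1) • ∑ x ∈ antidiagonal (a + 1),
        fullCoeff (mironCoeff G') x.1 (jetMap k τ p) * coordMat τ x.2 p =
        ((a : ℝ) + 1) • (coordMat τ 0 p * fullCoeff (mironCoeff G) (a + 1) p) := by
      rw [sub_eq_iff_eq_add.1 hcongr, ← Matrix.mul_smul, fullCoeff_mironCoeff_succ, ← mul_assoc,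
        ← sub_eq_iff_eq_add.2 law1.symm]
      simp only [Nat.cast_zero, zero_add, one_smul]
      noncomm_ring
    exact smul_right_injective _ (by positivity : ((a : ℝ) + 1) ≠ 0) hfin

end DualCoefficients

/-! ### The canonical semispray of a Lagrangian. -/

section Canonical

variable {n k : ℕ}

lemma contDiffOn_hessianMatrix {U : Set (JetModel n k)} (hU : IsOpen U) {L : JetModel n k → ℝ}
    (hL : ContDiffOn ℝ ∞ L U) (i j : Fin n) :
    ContDiffOn ℝ ∞ (fun p => hessianMatrix L p i j) U :=
  contDiffOn_const.mul (contDiffOn_pderivY hU (contDiffOn_pderivY hU hL k j) k i)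

lemma contDiffOn_canonicalCovector {U : Set (JetModel n k)} (hU : IsOpen U) {L : JetModel n k → ℝ}
    (hL : ContDiffOn ℝ ∞ L U) (j : Fin n) : ContDiffOn ℝ ∞ (canonicalCovector L j) U :=
  (contDiffOn_derivAlong hU contDiff_gammaField.contDiffOn (contDiffOn_pderivY hU hL k j)).sub
    (contDiffOn_pderivY hU hL (k - 1) j)

lemma contDiffOn_det {P ι : Type*} [NormedAddCommGroup P] [NormedSpace ℝ P] [Fintype ι]
    [DecidableEq ι] {U : Set P} {A : P → Matrix ι ι ℝ}
    (hA : ∀ i j, ContDiffOn ℝ ∞ (fun p => A p i j) U) : ContDiffOn ℝ ∞ (fun p => (A p).det) U := by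
  simp only [Matrix.det_apply']
  exact ContDiffOn.sum fun σ _ => contDiffOn_const.mul (contDiffOn_prod fun i _ => hA _ i)

/-- Cramer's rule: the entries are quotients of determinants, with non-vanishing denominator. -/
lemma contDiffOn_matrix_inv {P ι : Type*} [NormedAddCommGroup P] [NormedSpace ℝ P] [Fintype ι]
    [DecidableEq ι] {U : Set P} {A : P → Matrix ι ι ℝ}
    (hA : ∀ i j, ContDiffOn ℝ ∞ (fun p => A p i j) U) (h : ∀ p ∈ U, (A p).det ≠ 0) (i j : ι) :
    ContDiffOn ℝ ∞ (fun p => (A p)⁻¹ i j) U := by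
  simp only [Matrix.inv_def, Matrix.smul_apply, Ring.inverse_eq_inv', smul_eq_mul,
    Matrix.adjugate_apply]
  refine ((contDiffOn_det hA).inv h).mul (contDiffOn_det fun a b => ?_)
  by_cases hab : a = j
  · subst hab
    simp only [Matrix.updateRow_self]
    exact contDiffOn_const
  · simp only [Matrix.updateRow_ne hab]
    exact hA a b

lemma contDiffOn_canonicalSum {U : Set (JetModel n k)} (hU : IsOpen U) {L : JetModel n k → ℝ}
    (hL : ContDiffOn ℝ ∞ L U) (hpos : ∀ p ∈ U, (hessianMatrix L p).PosDef) (i : Fin n) :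
    ContDiffOn ℝ ∞ (fun p => ∑ j, (hessianMatrix L p)⁻¹ i j * canonicalCovector L j p) U :=
  ContDiffOn.sum fun j _ => (contDiffOn_matrix_inv (contDiffOn_hessianMatrix hU hL)
    (fun p hp => (hpos p hp).det_pos.ne') i j).mul (contDiffOn_canonicalCovector hU hL j)

lemma contDiffOn_canonicalCoeff {U : Set (JetModel n k)} (hU : IsOpen U) {L : JetModel n k → ℝ}
    (hL : ContDiffOn ℝ ∞ L U) (hpos : ∀ p ∈ U, (hessianMatrix L p).PosDef) (i : Fin n) :
    ContDiffOn ℝ ∞ (canonicalCoeff L i) U :=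
  contDiffOn_const.mul (contDiffOn_const.mul (contDiffOn_canonicalSum hU hL hpos i))

/-- Both recursions use the same semispray. Their starting matrices agree because the constant `1 /
(2(k+1))` moves past the derivative of a differentiable sum. -/
lemma cartanCoeff_eqOn {U : Set (JetModel n k)} (hU : IsOpen U) {L : JetModel n k → ℝ}
    (hL : ContDiffOn ℝ ∞ L U) (hpos : ∀ p ∈ U, (hessianMatrix L p).PosDef) (a : ℕ) (i j : Fin n) :
    Set.EqOn (cartanCoeff L a i j) (mironCoeff (canonicalCoeff L) a i j) U := by
  refine dualRecursion_congr hU (fun _ _ _ => rfl) (fun i j p hp => ?_) a i j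
  have hd := ((contDiffOn_canonicalSum hU hL hpos i).contDiffAt (hU.mem_nhds hp)).differentiableAt
    (by simp)
  have e : canonicalCoeff L i = fun q => (1 / (2 * ((k : ℝ) + 1))) *
      ∑ m, (hessianMatrix L q)⁻¹ i m * canonicalCovector L m q := by
    funext q
    unfold canonicalCoeff
    field_simp
  simp only [pderivY]
  rw [e, fderiv_const_mul hd]
  rfl

/-- The canonical coefficients are characterized by `S(∂L/∂y^(k)j) = ∂L/∂y^(k-1)j`. -/
lemma eq_canonicalCoeff_iff {L : JetModel n k → ℝ} {p : JetModel n k}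
    (hpos : (hessianMatrix L p).PosDef) (G : Fin n → JetModel n k → ℝ) :
    (∀ j, derivAlong (semisprayField G) (pderivY k j L) p = pderivY (k - 1) j L p) ↔
      ∀ i, G i p = canonicalCoeff L i p := by
  set g := hessianMatrix L p with hg
  have hk : ((k : ℝ) + 1) ≠ 0 := by positivity
  have hdet : IsUnit g.det := hpos.det_pos.ne'.isUnit
  have h1 : ∀ j, derivAlong (semisprayField G) (pderivY k j L) p =
      derivAlong gammaField (pderivY k j L) p -
        (g.mulVec fun i => 2 * ((k : ℝ) + 1) * G i p) j := by
    intro j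
    unfold derivAlong
    rw [semisprayField_eq, map_sub, map_smul, map_sum]
    congr 1
    simp only [map_smul, smul_eq_mul, Matrix.mulVec, dotProduct, Finset.mul_sum]
    refine Finset.sum_congr rfl fun i _ => ?_
    -- Symmetry of the Hessian is part of positive definiteness; no interchange of derivatives is
    -- needed.
    have hsymm : g j i = g i j := by
      have := congrFun (congrFun hpos.isHermitian i) j
      simpa using this
    have h2 : g i j = 1 / 2 * fderiv ℝ (pderivY k j L) p (basisVec k i) := rfl
    rw [hsymm, h2]
    ring
  have h2 : (∀ j, derivAlong (semisprayField G) (pderivY k j L) p = pderivY (k - 1) j L p) ↔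
      (g.mulVec fun i => 2 * ((k : ℝ) + 1) * G i p) = fun j => canonicalCovector L j p := by
    rw [funext_iff]
    refine forall_congr' fun j => ?_
    rw [h1, canonicalCovector]
    constructor <;> intro h <;> linarith
  have h3 : (g.mulVec fun i => 2 * ((k : ℝ) + 1) * G i p) = (fun j => canonicalCovector L j p) ↔
      (fun i => 2 * ((k : ℝ) + 1) * G i p) = g⁻¹.mulVec fun j => canonicalCovector L j p := by
    constructor
    · intro h
      rw [← h, Matrix.mulVec_mulVec, Matrix.nonsing_inv_mul _ hdet, Matrix.one_mulVec]
    · intro h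
      rw [h, Matrix.mulVec_mulVec, Matrix.mul_nonsing_inv _ hdet, Matrix.one_mulVec]
  rw [h2, h3, funext_iff]
  refine forall_congr' fun i => ?_
  unfold canonicalCoeff Matrix.mulVec dotProduct
  rw [← hg]
  constructor <;> intro h
  · rw [← h]
    field_simp
  · rw [h]
    field_simp

lemma fderiv_comp_jetMap_mul_coordMat {τ : EuclideanSpace ℝ (Fin n) → EuclideanSpace ℝ (Fin n)}
    {p : JetModel n k} (hτ : ContDiffAt ℝ ∞ τ (p 0)) {f : JetModel n k → ℝ}
    (hf : DifferentiableAt ℝ f (jetMap k τ p)) (m j : Fin n) (v : JetModel n k) :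
    fderiv ℝ (fun q => f (jetMap k τ q) * coordMat τ 0 q m j) p v =
      fderiv ℝ f (jetMap k τ p) (fderiv ℝ (jetMap k τ) p v) * coordMat τ 0 p m j +
        f (jetMap k τ p) * fderiv ℝ (fun q : JetModel n k => coordMat τ 0 q m j) p v := by
  have hf' : DifferentiableAt ℝ (fun q => f (jetMap k τ q)) p :=
    hf.comp p (differentiableAt_jetMap hτ)
  rw [fderiv_fun_mul hf' (differentiableAt_coordMat hτ 0 m j)]
  simp only [_root_.add_apply, _root_.smul_apply, smul_eq_mul]
  rw [fderiv_comp_jetMap hτ hf]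
  ring

/-- The canonical `k`-semispray does not depend on the coordinates. -/
lemma fderiv_jetMap_canonical {τ : EuclideanSpace ℝ (Fin n) → EuclideanSpace ℝ (Fin n)}
    (hk : 1 ≤ k) {U U' : Set (JetModel n k)} (hU : IsOpen U) (hU' : IsOpen U')
    (hτ : ∀ p ∈ U, ContDiffAt ℝ ∞ τ (p 0)) (hmaps : ∀ p ∈ U, jetMap k τ p ∈ U')
    {L L' : JetModel n k → ℝ} (hL' : ContDiffOn ℝ ∞ L' U')
    (h : ∀ p ∈ U, L p = L' (jetMap k τ p)) {p : JetModel n k} (hp : p ∈ U)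
    (hpos : (hessianMatrix L p).PosDef) (hpos' : (hessianMatrix L' (jetMap k τ p)).PosDef)
    (hunit : IsUnit (coordMat τ 0 p)) :
    fderiv ℝ (jetMap k τ) p (semisprayField (canonicalCoeff L) p) =
      semisprayField (canonicalCoeff L') (jetMap k τ p) := by
  set S := semisprayField (canonicalCoeff L)
  have hdL' : ∀ q ∈ U', DifferentiableAt ℝ L' q := fun q hq =>
    (hL'.contDiffAt (hU'.mem_nhds hq)).differentiableAt (by simp)
  have hdk : ∀ m, ∀ q ∈ U', DifferentiableAt ℝ (pderivY k m L') q := fun m q hq =>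
    ((contDiffOn_pderivY hU' hL' k m).contDiffAt (hU'.mem_nhds hq)).differentiableAt (by simp)
  have hev : ∀ q ∈ U, L =ᶠ[nhds q] fun q => L' (jetMap k τ q) := fun q hq =>
    (hU.eventually_mem hq).mono h
  -- The derivatives in `y^(k)` transform by `A₀` alone; those in `y^(k-1)`, in `e1`, pick up a term
  -- in `A₁`.
  have e0 : ∀ j, ∀ q ∈ U, pderivY k j L q =
      ∑ m, pderivY k m L' (jetMap k τ q) * coordMat τ 0 q m j := by
    intro j q hq
    have h1 := pderivY_comp_jetMap (hτ q hq) (hdL' _ (hmaps q hq)) (add_zero k) j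
    simp only [zero_add, Finset.sum_range_one, add_zero] at h1
    rw [← h1, pderivY, (hev q hq).fderiv_eq, pderivY]
  have e1 : ∀ j, pderivY (k - 1) j L p =
      ∑ m, pderivY (k - 1) m L' (jetMap k τ p) * coordMat τ 0 p m j +
        ∑ m, pderivY k m L' (jetMap k τ p) * coordMat τ 1 p m j := by
    intro j
    have h1 := pderivY_comp_jetMap (hτ p hp) (hdL' _ (hmaps p hp)) (Nat.sub_add_cancel hk) j
    rw [Finset.sum_range_succ, Finset.sum_range_one, Nat.sub_add_cancel hk, add_zero] at h1
    rw [← h1, pderivY, (hev p hp).fderiv_eq, pderivY]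
  -- Since `S A₀ = A₁`, the term in `A₁` of `e1` reappears here and cancels in the characterizing
  -- equation.
  have e2 : ∀ j, derivAlong S (pderivY k j L) p =
      ∑ m, fderiv ℝ (pderivY k m L') (jetMap k τ p) (fderiv ℝ (jetMap k τ) p (S p)) *
        coordMat τ 0 p m j + ∑ m, pderivY k m L' (jetMap k τ p) * coordMat τ 1 p m j := by
    intro j
    have hev' : pderivY k j L =ᶠ[nhds p] fun q =>
        ∑ m, pderivY k m L' (jetMap k τ q) * coordMat τ 0 q m j :=
      (hU.eventually_mem hp).mono (e0 j)
    have hd : ∀ m ∈ Finset.univ, DifferentiableAt ℝ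
        (fun q => pderivY k m L' (jetMap k τ q) * coordMat τ 0 q m j) p := fun m _ =>
      DifferentiableAt.mul
        ((hdk m _ (hmaps p hp)).comp p (differentiableAt_jetMap (hτ p hp)))
        (differentiableAt_coordMat (hτ p hp) 0 m j)
    rw [derivAlong, hev'.fderiv_eq, fderiv_fun_sum hd, _root_.sum_apply, ← Finset.sum_add_distrib]
    refine Finset.sum_congr rfl fun m _ => ?_
    rw [fderiv_comp_jetMap_mul_coordMat (hτ p hp) (hdk m _ (hmaps p hp)),
      fderiv_coordMat_semisprayField (hτ p hp) (by omega : 0 < k)]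
    simp
  have hcan := (eq_canonicalCoeff_iff hpos (canonicalCoeff L)).2 fun _ => rfl
  have hx : Matrix.vecMul (fun m => fderiv ℝ (pderivY k m L') (jetMap k τ p)
      (fderiv ℝ (jetMap k τ) p (S p)) - pderivY (k - 1) m L' (jetMap k τ p))
      (coordMat τ 0 p) = 0 := by
    funext j
    have h1 := hcan j
    rw [e1, e2] at h1
    have h2 := add_right_cancel h1
    simp only [Matrix.vecMul, dotProduct, sub_mul, Finset.sum_sub_distrib, h2, sub_self]
    rfl
  have hx' := (Matrix.vecMul_injective_iff_isUnit.2 hunit) (hx.trans (Matrix.zero_vecMul _).symm)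
  -- The image of `S p` is a semispray vector with these coefficients. The criterion
  -- `eq_canonicalCoeff_iff` is pointwise, so functions frozen at their value for `p` suffice.
  let G'' : Fin n → JetModel n k → ℝ := fun i _ =>
    ∑ j, coordMat τ 0 p i j * canonicalCoeff L j p - prolong τ (k + 1) p i
  have hG'' := (fderiv_jetMap_semisprayField (hτ p hp) (canonicalCoeff L) G'').2 fun _ => rfl
  have hc'' := (eq_canonicalCoeff_iff hpos' G'').1 fun m => by
    have := congrFun hx' m
    rw [derivAlong, ← hG'']
    exact sub_eq_zero.1 this
  rw [hG'', semisprayField_eq, semisprayField_eq]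
  simp only [hc'']

end Canonical

/-! ### Dilations and weights. -/

section Homogeneity

variable {n k : ℕ}

/-- The dilation as a continuous linear map. -/
def dilationL (c : ℝ) : JetModel n k →L[ℝ] JetModel n k :=
  ContinuousLinearMap.pi fun α => c ^ (α : ℕ) • ContinuousLinearMap.proj α

/-- The dilation is linear, hence its own derivative; the homogeneity identity holds near `p` and
can be differentiated. -/
lemma fderiv_dilation {U : Set (JetModel n k)} (hU : IsOpen U) {c m : ℝ}
    (hc : ∀ p ∈ U, dilation c p ∈ U) {f : JetModel n k → ℝ} (hf : ContDiffOn ℝ ∞ f U)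
    (h : ∀ p ∈ U, f (dilation c p) = m * f p) {p : JetModel n k} (hp : p ∈ U) (v : JetModel n k) :
    fderiv ℝ f (dilation c p) (dilation c v) = m * fderiv ℝ f p v := by
  have hd : ∀ q ∈ U, DifferentiableAt ℝ f q := fun q hq =>
    (hf.contDiffAt (hU.mem_nhds hq)).differentiableAt (by simp)
  have h1 : HasFDerivAt (fun q => f (dilation c q)) _ p :=
    HasFDerivAt.comp (f := dilationL c) p (hd _ (hc p hp)).hasFDerivAt (dilationL c).hasFDerivAt
  have hev : (fun q => f (dilation c q)) =ᶠ[nhds p] fun q => m * f q :=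
    (hU.eventually_mem hp).mono h
  have h2 := h1.fderiv
  rw [hev.fderiv_eq, fderiv_const_mul (hd p hp)] at h2
  exact (congrArg (fun l => l v) h2).symm

lemma dilation_basisVec (c : ℝ) (a : ℕ) (j : Fin n) :
    dilation c (basisVec a j : JetModel n k) = c ^ a • basisVec a j := by
  ext β i
  simp only [dilation, PiLp.smul_apply, Pi.smul_apply, basisVec_apply, smul_eq_mul]
  split_ifs with h
  · rw [h.1]
  · simp

/-- The component of Γ of order `α` is built from `y^(α+1)`, which carries one extra factor `c`. -/
lemma dilation_gammaField (c : ℝ) (p : JetModel n k) :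
    gammaField (dilation c p) = c • dilation c (gammaField p) := by
  ext β i
  refine Fin.lastCases ?_ (fun a => ?_) β
  · simp [dilation, gammaField]
  · simp [dilation, gammaField, pow_succ]
    ring

lemma pderivY_dilation {U : Set (JetModel n k)} (hU : IsOpen U) {c m : ℝ}
    (hc : ∀ p ∈ U, dilation c p ∈ U) {f : JetModel n k → ℝ} (hf : ContDiffOn ℝ ∞ f U)
    (h : ∀ p ∈ U, f (dilation c p) = m * f p) {p : JetModel n k} (hp : p ∈ U) (a : ℕ) (j : Fin n) :
    c ^ a * pderivY a j f (dilation c p) = m * pderivY a j f p := by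
  have := fderiv_dilation hU hc hf h hp (basisVec a j)
  rw [dilation_basisVec, map_smul] at this
  exact this

/-- A weight count: `∂/∂y^(a)` lowers the weight by `a` and Γ raises it by one. From `2k` both terms
of the covector reach `k + 1`, and the Hessian matrix, with its inverse, has weight `2k - k - k =
0`. -/
lemma canonicalCoeff_dilation (hk : 1 ≤ k) {U : Set (JetModel n k)} (hU : IsOpen U) {c : ℝ}
    (hc0 : 0 < c) (hc : ∀ p ∈ U, dilation c p ∈ U) {L : JetModel n k → ℝ}
    (hL : ContDiffOn ℝ ∞ L U) (h : ∀ p ∈ U, L (dilation c p) = c ^ (2 * k) * L p)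
    {p : JetModel n k} (hp : p ∈ U) (i : Fin n) :
    canonicalCoeff L i (dilation c p) = c ^ (k + 1) * canonicalCoeff L i p := by
  have h1 : ∀ j, ∀ q ∈ U, pderivY k j L (dilation c q) = c ^ k * pderivY k j L q := by
    intro j q hq
    have := pderivY_dilation hU hc hL h hq k j
    rw [two_mul, pow_add, mul_assoc] at this
    exact mul_left_cancel₀ (by positivity) this
  have h2 : ∀ j, pderivY (k - 1) j L (dilation c p) = c ^ (k + 1) * pderivY (k - 1) j L p := by
    intro j
    have := pderivY_dilation hU hc hL h hp (k - 1) j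
    rw [show 2 * k = (k - 1) + (k + 1) by omega, pow_add, mul_assoc] at this
    exact mul_left_cancel₀ (by positivity) this
  have h3 : hessianMatrix L (dilation c p) = hessianMatrix L p := by
    ext a b
    have := pderivY_dilation hU hc (contDiffOn_pderivY hU hL k b) (h1 b) hp k a
    simp only [hessianMatrix, Matrix.of_apply, mul_left_cancel₀ (by positivity) this]
  have h4 : ∀ j, canonicalCovector L j (dilation c p) = c ^ (k + 1) * canonicalCovector L j p := by
    intro j
    have := fderiv_dilation hU hc (contDiffOn_pderivY hU hL k j) (h1 j) hp (gammaField p)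
    unfold canonicalCovector derivAlong
    rw [h2, dilation_gammaField, map_smul, this, smul_eq_mul]
    ring
  unfold canonicalCoeff
  simp only [h3, h4, Finset.mul_sum]
  refine Finset.sum_congr rfl fun j _ => ?_
  ring

/-- Euler's theorem for functions homogeneous with respect to the dilations. -/
lemma derivAlong_liouville {f : JetModel n k → ℝ} {p : JetModel n k} (hf : DifferentiableAt ℝ f p)
    {m : ℕ} (h : ∀ c : ℝ, 0 < c → f (dilation c p) = c ^ m * f p) :
    derivAlong liouville f p = m * f p := by
  -- The Liouville field is the velocity of the dilations at `c = 1`; the two expressions for `f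
  -- (dilation c p)` are differentiated there.
  have h1 : HasDerivAt (fun c : ℝ => dilation c p) (liouville p) 1 := by
    refine hasDerivAt_pi.2 fun α => ?_
    have := (hasDerivAt_pow (α : ℕ) (1 : ℝ)).smul_const (p α)
    rw [one_pow, mul_one] at this
    exact this
  have e1 : dilation 1 p = p := by
    funext α
    simp [dilation]
  have h2 : HasDerivAt (fun c : ℝ => f (dilation c p)) (fderiv ℝ f p (liouville p)) 1 :=
    HasFDerivAt.comp_hasDerivAt (f := fun c : ℝ => dilation c p) 1
      (by rw [e1]; exact hf.hasFDerivAt) h1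
  have h3 : HasDerivAt (fun c : ℝ => c ^ m * f p) (m * f p) 1 := by
    simpa using (hasDerivAt_pow m (1 : ℝ)).mul_const (f p)
  have hev : (fun c : ℝ => f (dilation c p)) =ᶠ[nhds 1] fun c => c ^ m * f p :=
    (isOpen_Ioi.eventually_mem (show (1 : ℝ) ∈ Set.Ioi 0 by simp)).mono h
  exact h2.unique (h3.congr_of_eventuallyEq hev)

end Homogeneity

/-! ### Coordinate domains of the slit bundle. -/

section Domains

variable {n k : ℕ} {M : Type*} [TopologicalSpace M]

lemma isOpen_slitCoord (φ : OpenPartialHomeomorph M (EuclideanSpace ℝ (Fin n))) :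
    IsOpen (slitCoord k φ) :=
  (φ.open_target.preimage (continuous_apply 0)).inter
    (isOpen_compl_singleton.preimage (continuous_apply 1))

/-- The image in the first of two charts of the slit bundle over the intersection of their
domains. -/
def overlap (k : ℕ) (φ ψ : OpenPartialHomeomorph M (EuclideanSpace ℝ (Fin n))) :
    Set (JetModel n k) :=
  {p | p 0 ∈ (φ.symm.trans ψ).source ∧ p 1 ≠ 0}

lemma isOpen_overlap (φ ψ : OpenPartialHomeomorph M (EuclideanSpace ℝ (Fin n))) :
    IsOpen (overlap k φ ψ) :=
  ((φ.symm.trans ψ).open_source.preimage (continuous_apply 0)).inter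
    (isOpen_compl_singleton.preimage (continuous_apply 1))

lemma overlap_subset (φ ψ : OpenPartialHomeomorph M (EuclideanSpace ℝ (Fin n))) :
    overlap k φ ψ ⊆ slitCoord k φ :=
  fun _ hp => ⟨hp.1.1, hp.2⟩

lemma dilation_mem_slitCoord {φ : OpenPartialHomeomorph M (EuclideanSpace ℝ (Fin n))}
    {c : ℝ} (hc : 0 < c) {p : JetModel n k} (hp : p ∈ slitCoord k φ) :
    dilation c p ∈ slitCoord k φ := by
  refine ⟨?_, ?_⟩
  · simpa [dilation] using hp.1
  · exact smul_ne_zero (pow_pos hc _).ne' hp.2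

end Domains

/-! ### Induced charts, tangent components and vertical spaces. -/

section Charts

variable {n k : ℕ} {M : Type*} [TopologicalSpace M] [ChartedSpace (EuclideanSpace ℝ (Fin n)) M]
  {φ ψ : OpenPartialHomeomorph M (EuclideanSpace ℝ (Fin n))}

lemma jetCoord_zero_mem_target (hφ : φ ∈ LocalCharts n M) {u : AccBundle n k M}
    (hu : u.proj ∈ φ.source) : jetCoord k φ u 0 ∈ φ.target := by
  rw [jetCoord_zero hφ u hu]
  exact φ.map_source hu

lemma symm_jetCoord_zero (hφ : φ ∈ LocalCharts n M) {u : AccBundle n k M}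
    (hu : u.proj ∈ φ.source) : φ.symm (jetCoord k φ u 0) = u.proj := by
  rw [jetCoord_zero hφ u hu, φ.left_inv hu]

lemma jetCoord_jetInv_eq_jetMap (hφ : φ ∈ LocalCharts n M) (hψ : ψ ∈ LocalCharts n M)
    {p : JetModel n k} (hp : p 0 ∈ φ.target) (hp' : φ.symm (p 0) ∈ ψ.source) :
    jetCoord k ψ (jetInv φ p) = jetMap k (ψ ∘ φ.symm) p :=
  funext fun α => jetCoord_jetInv' hφ hψ hp hp' α

lemma jetCoord_eq_jetMap (hφ : φ ∈ LocalCharts n M) (hψ : ψ ∈ LocalCharts n M)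
    {u : AccBundle n k M} (hu : u.proj ∈ φ.source) (hu' : u.proj ∈ ψ.source) :
    jetCoord k ψ u = jetMap k (ψ ∘ φ.symm) (jetCoord k φ u) := by
  rw [← jetCoord_jetInv_eq_jetMap hφ hψ (jetCoord_zero_mem_target hφ hu)
    (by rwa [symm_jetCoord_zero hφ hu]), jetInv_jetCoord hφ hu]

lemma contDiffAt_trans_jetCoord (hφ : φ ∈ LocalCharts n M) (hψ : ψ ∈ LocalCharts n M)
    {u : AccBundle n k M} (hu : u.proj ∈ φ.source) (hu' : u.proj ∈ ψ.source) :
    ContDiffAt ℝ ∞ (ψ ∘ φ.symm) (jetCoord k φ u 0) :=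
  contDiffAt_chart_trans hφ hψ (jetCoord_zero_mem_target hφ hu)
    (by rwa [symm_jetCoord_zero hφ hu])

/-- Γ applied to the coefficient of order zero can be computed by the shift or by the chain rule. -/
lemma prolong_one (hk : 1 ≤ k) {F : Type*} [NormedAddCommGroup F] [NormedSpace ℝ F]
    {g : EuclideanSpace ℝ (Fin n) → F} {p : JetModel n k} (hg : ContDiffAt ℝ ∞ g (p 0)) :
    prolong g 1 p = fderiv ℝ g (p 0) (p 1) := by
  have h := fderiv_prolong_gammaField hg 0
  rw [fderiv_prolong hg] at h
  simp only [Nat.factorial_zero, Nat.cast_one, inv_one, iteratedDeriv_zero, one_smul,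
    polyCurve_zero, Nat.cast_zero, zero_add] at h
  rw [← h]
  have h0 := gammaField_apply p (show 0 < k by omega)
  -- Here `1 ≤ k` keeps the numeral `1` in `Fin (k + 1)` from wrapping round to `0`.
  have e1 : (⟨0 + 1, by omega⟩ : Fin (k + 1)) = 1 := by
    ext
    simp [Nat.mod_eq_of_lt (show 1 < k + 1 by omega)]
  rw [e1] at h0
  have h0' : gammaField p 0 = p 1 := by simpa using h0
  rw [h0']

lemma jetCoord_one (hk : 1 ≤ k) (hφ : φ ∈ LocalCharts n M) (hψ : ψ ∈ LocalCharts n M)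
    {u : AccBundle n k M} (hu : u.proj ∈ φ.source) (hu' : u.proj ∈ ψ.source) :
    jetCoord k ψ u 1 = fderiv ℝ (ψ ∘ φ.symm) (jetCoord k φ u 0) (jetCoord k φ u 1) := by
  rw [jetCoord_eq_jetMap hφ hψ hu hu', ← prolong_one hk (contDiffAt_trans_jetCoord hφ hψ hu hu')]
  have e1 : ((1 : Fin (k + 1)) : ℕ) = 1 := by
    simp [Nat.mod_eq_of_lt (show 1 < k + 1 by omega)]
  unfold jetMap
  rw [e1]

/-- `y^(1)` transforms linearly, so its vanishing in one chart forces its vanishing in the others,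
and a single chart decides. -/
lemma mem_slit_iff (hk : 1 ≤ k) (hφ : φ ∈ LocalCharts n M) {u : AccBundle n k M}
    (hu : u.proj ∈ φ.source) : u ∈ slit n k M ↔ jetCoord k φ u 1 ≠ 0 := by
  refine ⟨fun h => h φ hφ hu, fun h ψ hψ hu' h0 => h ?_⟩
  rw [jetCoord_one hk hψ hφ hu' hu, h0, map_zero]

lemma jetCoord_mem_slitCoord (hφ : φ ∈ LocalCharts n M) {u : AccBundle n k M}
    (hu : u.proj ∈ φ.source) (h : u ∈ slit n k M) : jetCoord k φ u ∈ slitCoord k φ :=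
  ⟨jetCoord_zero_mem_target hφ hu, h φ hφ hu⟩

lemma proj_jetInv_mem (hφ : φ ∈ LocalCharts n M) {p : JetModel n k} (hp : p 0 ∈ φ.target) :
    (jetInv φ p).proj ∈ φ.source := by
  rw [proj_jetInv hφ hp]
  exact φ.map_target hp

lemma jetInv_mem_slit (hk : 1 ≤ k) (hφ : φ ∈ LocalCharts n M) {p : JetModel n k}
    (hp : p ∈ slitCoord k φ) : jetInv φ p ∈ slit n k M := by
  rw [mem_slit_iff hk hφ (proj_jetInv_mem hφ hp.1), jetCoord_jetInv hφ hp.1]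
  exact hp.2

lemma jetCoord_mem_overlap (hφ : φ ∈ LocalCharts n M) {u : AccBundle n k M}
    (hu : u.proj ∈ φ.source) (hu' : u.proj ∈ ψ.source) (h : u ∈ slit n k M) :
    jetCoord k φ u ∈ overlap k φ ψ := by
  refine ⟨⟨jetCoord_zero_mem_target hφ hu, ?_⟩, h φ hφ hu⟩
  change φ.symm (jetCoord k φ u 0) ∈ ψ.source
  rwa [symm_jetCoord_zero hφ hu]

lemma contDiffAt_trans_of_mem_overlap (hφ : φ ∈ LocalCharts n M) (hψ : ψ ∈ LocalCharts n M)
    {p : JetModel n k} (hp : p ∈ overlap k φ ψ) : ContDiffAt ℝ ∞ (ψ ∘ φ.symm) (p 0) :=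
  contDiffAt_chart_trans hφ hψ hp.1.1 hp.1.2

lemma proj_jetInv_mem_of_mem_overlap (hφ : φ ∈ LocalCharts n M)
    {p : JetModel n k} (hp : p ∈ overlap k φ ψ) : (jetInv φ p).proj ∈ ψ.source := by
  rw [proj_jetInv hφ hp.1.1]
  exact hp.1.2

lemma jetMap_mem_slitCoord (hk : 1 ≤ k) (hφ : φ ∈ LocalCharts n M) (hψ : ψ ∈ LocalCharts n M)
    {p : JetModel n k} (hp : p ∈ overlap k φ ψ) : jetMap k (ψ ∘ φ.symm) p ∈ slitCoord k ψ := by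
  rw [← jetCoord_jetInv_eq_jetMap hφ hψ hp.1.1 hp.1.2]
  exact jetCoord_mem_slitCoord hψ (proj_jetInv_mem_of_mem_overlap hφ hp)
    (jetInv_mem_slit hk hφ (overlap_subset φ ψ hp))

lemma jetInv_jetMap (hφ : φ ∈ LocalCharts n M) (hψ : ψ ∈ LocalCharts n M)
    {p : JetModel n k} (hp : p ∈ overlap k φ ψ) :
    jetInv ψ (jetMap k (ψ ∘ φ.symm) p) = jetInv φ p := by
  rw [← jetCoord_jetInv_eq_jetMap hφ hψ hp.1.1 hp.1.2,
    jetInv_jetCoord hψ (proj_jetInv_mem_of_mem_overlap hφ hp)]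

/-- The Jacobian matrix of a change of charts is invertible. -/
lemma isUnit_coordMat_zero (hφ : φ ∈ LocalCharts n M) (hψ : ψ ∈ LocalCharts n M)
    {p : JetModel n k} (hp : p 0 ∈ φ.target) (hp' : φ.symm (p 0) ∈ ψ.source) :
    IsUnit (coordMat (ψ ∘ φ.symm) 0 p) := by
  set x := p 0
  set y := ψ (φ.symm x)
  have hy : ψ.symm y = φ.symm x := ψ.left_inv hp'
  have hyt : y ∈ ψ.target := ψ.map_source hp'
  have h1 : DifferentiableAt ℝ (ψ ∘ φ.symm) (φ (ψ.symm y)) := by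
    rw [hy, φ.right_inv hp]
    exact (contDiffAt_chart_trans hφ hψ hp hp').differentiableAt (by simp)
  have h2 : DifferentiableAt ℝ (φ ∘ ψ.symm) y :=
    (contDiffAt_chart_trans hψ hφ hyt (by rw [hy]; exact φ.map_target hp)).differentiableAt
      (by simp)
  have hev : (ψ ∘ φ.symm) ∘ (φ ∘ ψ.symm) =ᶠ[nhds y] id := by
    have ho : (ψ.symm.trans φ).source ∈ nhds y :=
      (ψ.symm.trans φ).open_source.mem_nhds ⟨hyt, by
        change ψ.symm y ∈ φ.source
        rw [hy]
        exact φ.map_target hp⟩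
    filter_upwards [ho] with z hz
    have hz2 : ψ.symm z ∈ φ.source := hz.2
    simp only [Function.comp_apply, id_eq, φ.left_inv hz2]
    exact ψ.right_inv hz.1
  have hcomp := fderiv_comp y h1 h2
  rw [hev.fderiv_eq, fderiv_id] at hcomp
  have hx : (φ ∘ ψ.symm) y = x := by
    simp only [Function.comp_apply, hy, φ.right_inv hp]
  rw [hx] at hcomp
  -- For a square matrix a one-sided inverse suffices: the Jacobian matrix of the reverse change of
  -- charts.
  refine IsUnit.of_mul_eq_one (Matrix.of fun i j =>
    fderiv ℝ (φ ∘ ψ.symm) y (EuclideanSpace.single j 1) i) ?_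
  ext i j
  have h3 := congrArg (fun l => l (EuclideanSpace.single j (1 : ℝ)) i) hcomp
  have h4 : fderiv ℝ (φ ∘ ψ.symm) y (EuclideanSpace.single j 1) =
      ∑ m, (fderiv ℝ (φ ∘ ψ.symm) y (EuclideanSpace.single j 1)) m •
        EuclideanSpace.single m (1 : ℝ) := by
    ext m
    simp [Finset.sum_apply, Pi.single_apply]
  simp only [ContinuousLinearMap.comp_apply, ContinuousLinearMap.id_apply] at h3
  rw [h4, map_sum] at h3
  simp only [map_smul, WithLp.ofLp_sum, Finset.sum_apply, WithLp.ofLp_smul, Pi.smul_apply,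
    smul_eq_mul] at h3
  simp only [Matrix.mul_apply, coordMat, Matrix.of_apply, prolong_zero, Matrix.one_apply]
  rw [Finset.sum_congr rfl fun m _ => mul_comm _ _]
  refine h3.symm.trans ?_
  simp

lemma chart_mdifferentiable (hφ : φ ∈ LocalCharts n M) :
    φ.MDifferentiable (𝓡 n) (𝓡 n) :=
  ⟨(contMDiffOn_of_mem_maximalAtlas hφ).mdifferentiableOn (by simp),
    (contMDiffOn_symm_of_mem_maximalAtlas hφ).mdifferentiableOn (by simp)⟩

variable [IsManifold (𝓡 n) ∞ M]

/-- The chart of `T^k M` induced by a chart of `M`. -/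
def jetChart (k : ℕ) (φ : OpenPartialHomeomorph M (EuclideanSpace ℝ (Fin n)))
    (hφ : φ ∈ LocalCharts n M) : OpenPartialHomeomorph (AccBundle n k M) (JetModel n k) :=
  (accCore n k M).openPartialHomeomorph (jetPartialEquiv k φ hφ) ⟨φ, hφ, rfl⟩

lemma jetChart_mem_atlas (hφ : φ ∈ LocalCharts n M) :
    jetChart k φ hφ ∈ atlas (JetModel n k) (AccBundle n k M) := by
  have hat : atlas (JetModel n k) (AccBundle n k M) =
    ⋃ (e : PartialEquiv (AccBundle n k M) (JetModel n k)) (he : e ∈ (accCore n k M).atlas),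
      {(accCore n k M).openPartialHomeomorph e he} := rfl
  rw [hat]
  simp only [Set.mem_iUnion, Set.mem_singleton_iff]
  exact ⟨_, ⟨φ, hφ, rfl⟩, rfl⟩

lemma jetChart_mdifferentiable (hφ : φ ∈ LocalCharts n M) :
    (jetChart k φ hφ).MDifferentiable 𝓘(ℝ, JetModel n k) 𝓘(ℝ, JetModel n k) := by
  have : IsManifold 𝓘(ℝ, JetModel n k) 1 (AccBundle n k M) :=
    IsManifold.of_le (n := ∞) (by exact_mod_cast le_top)
  exact mdifferentiable_of_mem_atlas (jetChart_mem_atlas hφ)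

lemma mdifferentiableAt_jetCoord (hφ : φ ∈ LocalCharts n M) {u : AccBundle n k M}
    (hu : u.proj ∈ φ.source) :
    MDifferentiableAt 𝓘(ℝ, JetModel n k) 𝓘(ℝ, JetModel n k) (jetCoord k φ) u :=
  (jetChart_mdifferentiable hφ).mdifferentiableAt hu

lemma isOpen_proj_preimage (hφ : φ ∈ LocalCharts n M) :
    IsOpen {u : AccBundle n k M | u.proj ∈ φ.source} :=
  (jetChart k φ hφ).open_source

lemma tangentCoord_bijective (hφ : φ ∈ LocalCharts n M) {u : AccBundle n k M}
    (hu : u.proj ∈ φ.source) : Function.Bijective (tangentCoord φ u) :=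
  (jetChart_mdifferentiable (k := k) hφ).mfderiv_bijective (x := u) hu

/-- Components of tangent vectors transform by the derivative of the change of coordinates. -/
lemma tangentCoord_trans (hφ : φ ∈ LocalCharts n M) (hψ : ψ ∈ LocalCharts n M)
    {u : AccBundle n k M} (hu : u.proj ∈ φ.source) (hu' : u.proj ∈ ψ.source)
    (X : TangentSpace 𝓘(ℝ, JetModel n k) u) :
    tangentCoord ψ u X =
      fderiv ℝ (jetMap k (ψ ∘ φ.symm)) (jetCoord k φ u) (tangentCoord φ u X) := by
  have hev : jetCoord k ψ =ᶠ[nhds u] jetMap k (ψ ∘ φ.symm) ∘ jetCoord k φ := by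
    filter_upwards [(isOpen_proj_preimage hφ).mem_nhds hu,
      (isOpen_proj_preimage hψ).mem_nhds hu'] with w hw hw'
    exact jetCoord_eq_jetMap hφ hψ hw hw'
  have hd := differentiableAt_jetMap (contDiffAt_trans_jetCoord hφ hψ hu hu')
  have h1 := mfderiv_comp (I := 𝓘(ℝ, JetModel n k)) (I' := 𝓘(ℝ, JetModel n k))
    (I'' := 𝓘(ℝ, JetModel n k)) u hd.mdifferentiableAt (mdifferentiableAt_jetCoord hφ hu)
  rw [← hev.mfderiv_eq, mfderiv_eq_fderiv] at h1
  exact congrArg (fun l => l X) h1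

/-- In charts the projection of the bundle is the component of order zero, and the derivative of `φ`
is injective, so composing with it loses nothing. -/
lemma mem_vertical_iff (hφ : φ ∈ LocalCharts n M) {u : AccBundle n k M}
    (hu : u.proj ∈ φ.source) (X : TangentSpace 𝓘(ℝ, JetModel n k) u) :
    X ∈ vertical u ↔ tangentCoord φ u X 0 = 0 := by
  let pr : JetModel n k →L[ℝ] EuclideanSpace ℝ (Fin n) := ContinuousLinearMap.proj 0
  have hpr : MDifferentiableAt 𝓘(ℝ, JetModel n k) (𝓡 n) (pr ∘ jetCoord k φ) u :=
    pr.differentiableAt.mdifferentiableAt.comp u (mdifferentiableAt_jetCoord hφ hu)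
  have hproj : MDifferentiableAt 𝓘(ℝ, JetModel n k) (𝓡 n)
      (AccBundle.proj : AccBundle n k M → M) u := by
    have hs : MDifferentiableAt (𝓡 n) (𝓡 n) φ.symm ((pr ∘ jetCoord k φ) u) :=
      (chart_mdifferentiable hφ).mdifferentiableAt_symm (jetCoord_zero_mem_target hφ hu)
    refine (hs.comp u hpr).congr_of_eventuallyEq ?_
    filter_upwards [(isOpen_proj_preimage hφ).mem_nhds hu] with w hw
    exact (symm_jetCoord_zero hφ hw).symm
  have hev : φ ∘ (AccBundle.proj : AccBundle n k M → M) =ᶠ[nhds u] pr ∘ jetCoord k φ := by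
    filter_upwards [(isOpen_proj_preimage hφ).mem_nhds hu] with w hw
    exact (jetCoord_zero hφ w hw).symm
  have h1 := mfderiv_comp u ((chart_mdifferentiable hφ).mdifferentiableAt hu) hproj
  have h2 := mfderiv_comp (I := 𝓘(ℝ, JetModel n k)) (I' := 𝓘(ℝ, JetModel n k))
    (I'' := 𝓡 n) u (pr.differentiableAt (x := jetCoord k φ u)).mdifferentiableAt
    (mdifferentiableAt_jetCoord hφ hu)
  rw [hev.mfderiv_eq, h2, mfderiv_eq_fderiv, pr.fderiv] at h1
  have h3 : pr (tangentCoord φ u X) = mfderiv (𝓡 n) (𝓡 n) φ u.proj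
      (mfderiv 𝓘(ℝ, JetModel n k) (𝓡 n) (AccBundle.proj : AccBundle n k M → M) u X) :=
    congrArg (fun l => l X) h1
  have hinj := (chart_mdifferentiable hφ).mfderiv_injective hu
  change mfderiv 𝓘(ℝ, JetModel n k) (𝓡 n) (AccBundle.proj : AccBundle n k M → M) u X = 0 ↔
    pr (tangentCoord φ u X) = 0
  rw [h3]
  exact ⟨fun h => by rw [h]; exact map_zero _, fun h => hinj (h.trans (map_zero _).symm)⟩

lemma fieldCoord_jetCoord (hφ : φ ∈ LocalCharts n M)
    (X : ∀ u : slit n k M, TangentSpace 𝓘(ℝ, JetModel n k) (u : AccBundle n k M))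
    (u : slit n k M) (hu : u.1.proj ∈ φ.source) :
    fieldCoord X φ (jetCoord k φ u.1) = tangentCoord φ u.1 (X u) := by
  obtain ⟨w, hw⟩ := u
  -- The base point is made a variable so that its equality with `w` can be substituted in the
  -- dependent type.
  have key : ∀ v : AccBundle n k M, v = w →
      (open Classical in
        if h : v ∈ slit n k M then tangentCoord φ v (X ⟨v, h⟩) else 0) =
      tangentCoord φ w (X ⟨w, hw⟩) := by
    rintro v rfl
    exact dif_pos hw
  exact key _ (jetInv_jetCoord hφ hu)

end Charts

/-! ### Horizontal lifts from dual coefficients. -/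

section HorizontalLift

open Finset.HasAntidiagonal (antidiagonal)

variable {n k : ℕ}

/-- The matrices of the horizontal lift determined by dual coefficients. -/
def liftMat (C : ℕ → Fin n → Fin n → JetModel n k → ℝ) (p : JetModel n k) :
    ℕ → Matrix (Fin n) (Fin n) ℝ
  | 0 => 1
  | a + 1 => -∑ b : Fin (a + 1), fullCoeff C (a + 1 - b) p * liftMat C p b
decreasing_by exact b.2

lemma liftMat_eq (C : ℕ → Fin n → Fin n → JetModel n k → ℝ) (p : JetModel n k) {a : ℕ}
    (ha : a ≠ 0) :
    liftMat C p a = -∑ b ∈ Finset.range a, fullCoeff C (a - b) p * liftMat C p b := by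
  obtain ⟨a, rfl⟩ := Nat.exists_eq_succ_of_ne_zero ha
  rw [liftMat, Fin.sum_univ_eq_sum_range (fun b => fullCoeff C (a + 1 - b) p * liftMat C p b)]

lemma contDiffOn_liftMat {U : Set (JetModel n k)} {C : ℕ → Fin n → Fin n → JetModel n k → ℝ}
    (hC : ∀ a i j, ContDiffOn ℝ ∞ (C a i j) U) (a : ℕ) :
    ∀ i j, ContDiffOn ℝ ∞ (fun p => liftMat C p a i j) U := by
  induction a using Nat.strong_induction_on with
  | _ a ih =>
    intro i j
    rcases eq_or_ne a 0 with rfl | ha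
    · simp only [liftMat]
      exact contDiffOn_const
    · simp only [liftMat_eq C _ ha, Matrix.neg_apply, Matrix.sum_apply, Matrix.mul_apply]
      exact (ContDiffOn.sum fun b hb => ContDiffOn.sum fun m _ =>
        (contDiffOn_fullCoeff hC _ i m).mul (ih b (Finset.mem_range.1 hb) m j)).neg

/-- The horizontal lift determined by dual coefficients. -/
def liftMap (C : ℕ → Fin n → Fin n → JetModel n k → ℝ) (p : JetModel n k) :
    EuclideanSpace ℝ (Fin n) →L[ℝ] JetModel n k :=
  ∑ α : Fin (k + 1), ∑ i, ∑ j, liftMat C p α i j •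
    (EuclideanSpace.proj (𝕜 := ℝ) j).smulRight (basisVec (α : ℕ) i)

lemma contDiffOn_liftMap {U : Set (JetModel n k)} {C : ℕ → Fin n → Fin n → JetModel n k → ℝ}
    (hC : ∀ a i j, ContDiffOn ℝ ∞ (C a i j) U) : ContDiffOn ℝ ∞ (liftMap C) U :=
  ContDiffOn.sum fun α _ => ContDiffOn.sum fun i _ => ContDiffOn.sum fun j _ =>
    (contDiffOn_liftMat hC α i j).smul contDiffOn_const

lemma liftMap_apply (C : ℕ → Fin n → Fin n → JetModel n k → ℝ) (p : JetModel n k)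
    (e : EuclideanSpace ℝ (Fin n)) (α : Fin (k + 1)) :
    (liftMap C p e α : Fin n → ℝ) = (liftMat C p α).mulVec e := by
  have h := eq_sum_basisVec (fun α : Fin (k + 1) => WithLp.toLp 2 ((liftMat C p α).mulVec e))
  have h2 : liftMap C p e = fun α : Fin (k + 1) => WithLp.toLp 2 ((liftMat C p α).mulVec e) := by
    rw [h]
    simp only [liftMap, _root_.sum_apply, _root_.smul_apply, ContinuousLinearMap.smulRight_apply,
      Matrix.mulVec, dotProduct, Finset.sum_smul, smul_smul]
    rfl
  rw [h2]

lemma dualForm_eq_zero_iff (C : ℕ → Fin n → Fin n → JetModel n k → ℝ) (α : Fin (k + 1))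
    (p v : JetModel n k) :
    (∀ i, dualForm C α i p v = 0) ↔
      jetVec v α = -∑ b ∈ Finset.range α, (fullCoeff C (α - b) p).mulVec (jetVec v b) := by
  simp only [dualForm_eq]
  rw [← Finset.Nat.sum_antidiagonal_swap, Finset.Nat.sum_antidiagonal_eq_sum_range_succ_mk,
    Finset.sum_range_succ]
  simp only [Prod.swap, Nat.sub_self]
  have h1 : (fullCoeff C 0 p).mulVec (jetVec v α) = jetVec v α := by simp [fullCoeff]
  rw [h1, eq_neg_iff_add_eq_zero, funext_iff, add_comm]
  rfl

/-- The equations `δy^(α) = 0` form a unitriangular system: each determines `v α` from the lower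
components, so the solutions are parametrized by `v 0`, and `liftMat` records the solution. -/
lemma dualForm_eq_zero_iff_liftMap (C : ℕ → Fin n → Fin n → JetModel n k → ℝ)
    (p v : JetModel n k) :
    (∀ α : Fin (k + 1), α ≠ 0 → ∀ i, dualForm C α i p v = 0) ↔ ∃ e, v = liftMap C p e := by
  constructor
  · intro h
    refine ⟨v 0, ?_⟩
    have key : ∀ a ≤ k, jetVec v a = (liftMat C p a).mulVec (v 0) := by
      intro a
      induction a using Nat.strong_induction_on with
      | _ a ih =>
        intro ha
        rcases eq_or_ne a 0 with rfl | ha0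
        · simp [liftMat, jetVec]
        · have hne : (⟨a, by omega⟩ : Fin (k + 1)) ≠ 0 := fun h => ha0 (congrArg Fin.val h)
          have := (dualForm_eq_zero_iff C ⟨a, by omega⟩ p v).1 (h _ hne)
          simp only at this
          rw [this, liftMat_eq C p ha0, Matrix.neg_mulVec, Matrix.sum_mulVec]
          congr 1
          refine Finset.sum_congr rfl fun b hb => ?_
          have hb' := Finset.mem_range.1 hb
          rw [ih b hb' (by omega), Matrix.mulVec_mulVec]
    ext α i
    rw [liftMap_apply, ← key α (Nat.lt_succ_iff.1 α.2), jetVec_coe]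
  · rintro ⟨e, rfl⟩ α hα
    rw [dualForm_eq_zero_iff, jetVec_coe, liftMap_apply]
    have ha0 : (α : ℕ) ≠ 0 := fun h => hα (Fin.ext h)
    rw [liftMat_eq C p ha0, Matrix.neg_mulVec, Matrix.sum_mulVec]
    congr 1
    refine Finset.sum_congr rfl fun b hb => ?_
    have hb' := Finset.mem_range.1 hb
    have := α.2
    have h1 : jetVec (liftMap C p e) b = (liftMat C p b).mulVec e := by
      rw [← liftMap_apply C p e ⟨b, by omega⟩, ← jetVec_coe]
    rw [h1, Matrix.mulVec_mulVec]

lemma liftMap_apply_zero (C : ℕ → Fin n → Fin n → JetModel n k → ℝ) (p : JetModel n k)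
    (e : EuclideanSpace ℝ (Fin n)) : liftMap C p e 0 = e := by
  ext i
  rw [liftMap_apply]
  simp [liftMat]

end HorizontalLift

/-! ### Gluing local coefficients into connections and semisprays. -/

section Objects

variable {n k : ℕ} {M : Type*} [TopologicalSpace M] [ChartedSpace (EuclideanSpace ℝ (Fin n)) M]
  [IsManifold (𝓡 n) ∞ M]

/-- Dual coefficients that obey the transformation law define a nonlinear connection. -/
lemma exists_nonlinearConnection
    (C : OpenPartialHomeomorph M (EuclideanSpace ℝ (Fin n)) →
      ℕ → Fin n → Fin n → JetModel n k → ℝ)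
    (hC : ∀ φ ∈ LocalCharts n M, ∀ a i j, ContDiffOn ℝ ∞ (C φ a i j) (slitCoord k φ))
    (hlaw : ∀ φ ∈ LocalCharts n M, ∀ ψ ∈ LocalCharts n M, ∀ p ∈ overlap k φ ψ,
      DualLaw (ψ ∘ φ.symm) (C φ) (C ψ) p) :
    ∃ N : NonlinearConnection n k M, ∀ φ ∈ LocalCharts n M, N.HasDualCoeff φ (C φ) := by
  let ch : AccBundle n k M → OpenPartialHomeomorph M (EuclideanSpace ℝ (Fin n)) :=
    fun u => chartAt (EuclideanSpace ℝ (Fin n)) u.proj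
  have hch : ∀ u, ch u ∈ LocalCharts n M := fun u => IsManifold.chart_mem_maximalAtlas u.proj
  have hsrc : ∀ u : AccBundle n k M, u.proj ∈ (ch u).source := fun u =>
    mem_chart_source (EuclideanSpace ℝ (Fin n)) u.proj
  -- Each horizontal space is defined in the preferred chart at its point; `hmem` transfers the
  -- description to every chart.
  let hor : ∀ u : slit n k M, Submodule ℝ (TangentSpace 𝓘(ℝ, JetModel n k) (u : AccBundle n k M)) :=
    fun u => (LinearMap.range (liftMap (C (ch u.1)) (jetCoord k (ch u.1) u.1)).toLinearMap).comap
      (tangentCoord (ch u.1) u.1).toLinearMap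
  have hmem : ∀ φ ∈ LocalCharts n M, ∀ u : slit n k M, u.1.proj ∈ φ.source →
      ∀ X : TangentSpace 𝓘(ℝ, JetModel n k) (u : AccBundle n k M),
        X ∈ hor u ↔ ∀ α : Fin (k + 1), α ≠ 0 → ∀ i,
          dualForm (C φ) α i (jetCoord k φ u.1) (tangentCoord φ u.1 X) = 0 := by
    intro φ hφ u hu X
    have h1 : X ∈ hor u ↔ ∃ e, tangentCoord (ch u.1) u.1 X =
        liftMap (C (ch u.1)) (jetCoord k (ch u.1) u.1) e :=
      exists_congr fun e => eq_comm
    rw [h1, ← dualForm_eq_zero_iff_liftMap]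
    have hunit := isUnit_coordMat_zero (hch u.1) hφ (jetCoord_zero_mem_target (hch u.1) (hsrc u.1))
      (by rwa [symm_jetCoord_zero (hch u.1) (hsrc u.1)])
    have hl := (hlaw _ (hch u.1) φ hφ _
      (jetCoord_mem_overlap (hch u.1) (hsrc u.1) hu u.2)).dualForm_fderiv
        (contDiffAt_trans_jetCoord (hch u.1) hφ (hsrc u.1) hu) (tangentCoord (ch u.1) u.1 X)
    rw [← tangentCoord_trans (hch u.1) hφ (hsrc u.1) hu,
      ← jetCoord_eq_jetMap (hch u.1) hφ (hsrc u.1) hu] at hl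
    refine forall_congr' fun α => imp_congr_right fun _ => ?_
    -- The forms of the two charts differ by the invertible `A₀`, so they vanish together.
    have hinj := Matrix.mulVec_injective_iff_isUnit.2 hunit
    constructor
    · intro h i
      rw [hl, funext h]
      exact congrFun (Matrix.mulVec_zero _) i
    · intro h
      have h0 : (coordMat (φ ∘ (ch u.1).symm) 0 (jetCoord k (ch u.1) u.1)).mulVec
          (fun j => dualForm (C (ch u.1)) α j (jetCoord k (ch u.1) u.1)
            (tangentCoord (ch u.1) u.1 X)) = 0 :=
        funext fun i => (hl α i).symm.trans (h i)
      exact congrFun (hinj (h0.trans (Matrix.mulVec_zero _).symm))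
  have hlift : ∀ φ ∈ LocalCharts n M, ∀ u : slit n k M, u.1.proj ∈ φ.source →
      ∀ X : TangentSpace 𝓘(ℝ, JetModel n k) (u : AccBundle n k M),
        X ∈ hor u ↔ ∃ e, tangentCoord φ u.1 X = liftMap (C φ) (jetCoord k φ u.1) e :=
    fun φ hφ u hu X => (hmem φ hφ u hu X).trans (dualForm_eq_zero_iff_liftMap _ _ _)
  refine ⟨⟨hor, fun u => ?_, fun φ hφ => ⟨liftMap (C φ), contDiffOn_liftMap (hC φ hφ),
    hlift φ hφ⟩⟩, hmem⟩
  have hbij := tangentCoord_bijective (hch u.1) (hsrc u.1)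
  constructor
  · rw [Submodule.disjoint_def]
    intro X hX hV
    obtain ⟨e, he⟩ := (hlift _ (hch u.1) u (hsrc u.1) X).1 hX
    have h0 := (mem_vertical_iff (hch u.1) (hsrc u.1) X).1 hV
    rw [he, liftMap_apply_zero] at h0
    rw [h0, map_zero] at he
    exact hbij.1 (he.trans (map_zero _).symm)
  · rw [codisjoint_iff, Submodule.eq_top_iff']
    intro X
    -- The horizontal part of `X` is the lift of its component of order zero; the remainder has none
    -- and is vertical.
    obtain ⟨Y, hY⟩ := hbij.2 (liftMap (C (ch u.1)) (jetCoord k (ch u.1) u.1)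
      (tangentCoord (ch u.1) u.1 X 0))
    refine Submodule.mem_sup.2 ⟨Y, (hlift _ (hch u.1) u (hsrc u.1) Y).2 ⟨_, hY⟩, X - Y, ?_,
      add_sub_cancel _ _⟩
    rw [mem_vertical_iff (hch u.1) (hsrc u.1), map_sub, hY]
    change tangentCoord (ch u.1) u.1 X 0 - liftMap _ _ _ 0 = 0
    rw [liftMap_apply_zero, sub_self]

lemma NonlinearConnection.eq_of_hasDualCoeff {N N' : NonlinearConnection n k M}
    {C : OpenPartialHomeomorph M (EuclideanSpace ℝ (Fin n)) →
      ℕ → Fin n → Fin n → JetModel n k → ℝ}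
    (h : ∀ φ ∈ LocalCharts n M, N.HasDualCoeff φ (C φ))
    (h' : ∀ φ ∈ LocalCharts n M, N'.HasDualCoeff φ (C φ)) : N = N' := by
  ext u X
  have hφ := IsManifold.chart_mem_maximalAtlas (I := 𝓡 n) (n := ∞) u.1.proj
  have hu := mem_chart_source (EuclideanSpace ℝ (Fin n)) u.1.proj
  rw [h _ hφ u hu X, h' _ hφ u hu X]

lemma NonlinearConnection.HasDualCoeff.congr {N : NonlinearConnection n k M}
    {φ : OpenPartialHomeomorph M (EuclideanSpace ℝ (Fin n))} (hφ : φ ∈ LocalCharts n M)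
    {C C' : ℕ → Fin n → Fin n → JetModel n k → ℝ} (h : N.HasDualCoeff φ C)
    (hC : ∀ a i j, Set.EqOn (C a i j) (C' a i j) (slitCoord k φ)) : N.HasDualCoeff φ C' := by
  intro u hu X
  rw [h u hu X]
  have hp := jetCoord_mem_slitCoord hφ hu u.2
  simp only [dualForm, fun a i j => hC a i j hp]

/-- `J` forgets exactly the last component, so the equation fixes all the others; the normalization
of the coefficients makes the last one reproduce itself. -/
lemma tangentStructure_eq_liouville_iff (p v : JetModel n k) :
    tangentStructure v = liouville p ↔
      v = semisprayField (fun i _ => -(1 / ((k : ℝ) + 1)) * v (Fin.last k) i) p := by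
  have hk : ((k : ℝ) + 1) ≠ 0 := by positivity
  constructor
  · intro h
    funext α
    refine Fin.lastCases ?_ (fun a => ?_) α
    · rw [semisprayField_last]
      ext i
      simp only
      field_simp
    · have := congrFun h a.succ
      simp only [tangentStructure, Fin.cons_succ, liouville, Fin.val_succ, Nat.cast_add,
        Nat.cast_one] at this
      rw [this]
      simp [semisprayField]
  · intro h
    funext α
    refine Fin.cases ?_ (fun a => ?_) α
    · simp [tangentStructure, liouville]
    · simp only [tangentStructure, Fin.cons_succ, liouville, Fin.val_succ, Nat.cast_add,
        Nat.cast_one]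
      rw [h]
      simp [semisprayField]

variable {φ : OpenPartialHomeomorph M (EuclideanSpace ℝ (Fin n))}

lemma KSemispray.tangentCoord_field (S : KSemispray n k M) (hφ : φ ∈ LocalCharts n M)
    (u : slit n k M) (hu : u.1.proj ∈ φ.source) :
    tangentCoord φ u.1 (S.field u) = semisprayField (S.coeff φ) (jetCoord k φ u.1) := by
  have h := (tangentStructure_eq_liouville_iff _ _).1 (S.tangentStructure_field φ hφ u hu)
  refine h.trans ?_
  rw [semisprayField_eq, semisprayField_eq]
  simp only [KSemispray.coeff, fieldCoord_jetCoord hφ S.field u hu]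

lemma KSemispray.contDiffOn_coeff (S : KSemispray n k M) (hφ : φ ∈ LocalCharts n M) (i : Fin n) :
    ContDiffOn ℝ ∞ (S.coeff φ i) (slitCoord k φ) := by
  let l : JetModel n k →L[ℝ] ℝ :=
    (EuclideanSpace.proj (𝕜 := ℝ) i).comp (ContinuousLinearMap.proj (Fin.last k))
  exact contDiffOn_const.mul (l.contDiff.comp_contDiffOn (S.smooth φ hφ))

/-- The transformation law of the coefficients of a `k`-semispray. -/
lemma KSemispray.coeff_jetMap (S : KSemispray n k M) (hk : 1 ≤ k)
    {ψ : OpenPartialHomeomorph M (EuclideanSpace ℝ (Fin n))}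
    (hφ : φ ∈ LocalCharts n M) (hψ : ψ ∈ LocalCharts n M) {p : JetModel n k}
    (hp : p ∈ overlap k φ ψ) (i : Fin n) :
    S.coeff ψ i (jetMap k (ψ ∘ φ.symm) p) =
      ∑ j, coordMat (ψ ∘ φ.symm) 0 p i j * S.coeff φ j p - prolong (ψ ∘ φ.symm) (k + 1) p i := by
  refine (fderiv_jetMap_semisprayField (contDiffAt_trans_of_mem_overlap hφ hψ hp) _ _).1 ?_ i
  have hslit := jetInv_mem_slit hk hφ (overlap_subset φ ψ hp)
  have hu := proj_jetInv_mem hφ hp.1.1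
  have hu' := proj_jetInv_mem_of_mem_overlap hφ hp
  have h1 := S.tangentCoord_field hφ ⟨_, hslit⟩ hu
  have h2 := S.tangentCoord_field hψ ⟨_, hslit⟩ hu'
  have h3 := tangentCoord_trans hφ hψ hu hu' (S.field ⟨_, hslit⟩)
  rw [h1, h2] at h3
  rw [jetCoord_eq_jetMap hφ hψ hu hu', jetCoord_jetInv hφ hp.1.1] at h3
  exact h3.symm

/-- At each point the coefficients give the tangent components, which determine the vector. -/
lemma KSemispray.ext_coeff {S S' : KSemispray n k M}
    (h : ∀ φ ∈ LocalCharts n M, ∀ i, ∀ p ∈ slitCoord k φ, S.coeff φ i p = S'.coeff φ i p) :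
    S = S' := by
  ext u
  have hφ := IsManifold.chart_mem_maximalAtlas (I := 𝓡 n) (n := ∞) u.1.proj
  have hu := mem_chart_source (EuclideanSpace ℝ (Fin n)) u.1.proj
  refine (tangentCoord_bijective hφ hu).1 ?_
  rw [S.tangentCoord_field hφ u hu, S'.tangentCoord_field hφ u hu, semisprayField_eq,
    semisprayField_eq]
  simp only [fun i => h _ hφ i _ (jetCoord_mem_slitCoord hφ hu u.2)]

/-- Local coefficients whose vector fields are related by the changes of coordinates define a
`k`-semispray. -/
lemma exists_kSemispray (hk : 1 ≤ k)
    (G : OpenPartialHomeomorph M (EuclideanSpace ℝ (Fin n)) → Fin n → JetModel n k → ℝ)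
    (hG : ∀ φ ∈ LocalCharts n M, ∀ i, ContDiffOn ℝ ∞ (G φ i) (slitCoord k φ))
    (hlaw : ∀ φ ∈ LocalCharts n M, ∀ ψ ∈ LocalCharts n M, ∀ p ∈ overlap k φ ψ,
      fderiv ℝ (jetMap k (ψ ∘ φ.symm)) p (semisprayField (G φ) p) =
        semisprayField (G ψ) (jetMap k (ψ ∘ φ.symm) p)) :
    ∃ S : KSemispray n k M, ∀ φ ∈ LocalCharts n M, ∀ i, ∀ p ∈ slitCoord k φ,
      S.coeff φ i p = G φ i p := by
  let ch : AccBundle n k M → OpenPartialHomeomorph M (EuclideanSpace ℝ (Fin n)) :=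
    fun u => chartAt (EuclideanSpace ℝ (Fin n)) u.proj
  have hch : ∀ u, ch u ∈ LocalCharts n M := fun u => IsManifold.chart_mem_maximalAtlas u.proj
  have hsrc : ∀ u : AccBundle n k M, u.proj ∈ (ch u).source := fun u =>
    mem_chart_source (EuclideanSpace ℝ (Fin n)) u.proj
  choose X hX using fun u : slit n k M => (tangentCoord_bijective (hch u.1) (hsrc u.1)).2
    (semisprayField (G (ch u.1)) (jetCoord k (ch u.1) u.1))
  have hX' : ∀ φ ∈ LocalCharts n M, ∀ u : slit n k M, u.1.proj ∈ φ.source →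
      tangentCoord φ u.1 (X u) = semisprayField (G φ) (jetCoord k φ u.1) := by
    intro φ hφ u hu
    rw [tangentCoord_trans (hch u.1) hφ (hsrc u.1) hu, hX,
      hlaw _ (hch u.1) φ hφ _ (jetCoord_mem_overlap (hch u.1) (hsrc u.1) hu u.2),
      ← jetCoord_eq_jetMap (hch u.1) hφ (hsrc u.1) hu]
  have hfield : ∀ φ ∈ LocalCharts n M, ∀ p ∈ slitCoord k φ,
      fieldCoord X φ p = semisprayField (G φ) p := by
    intro φ hφ p hp
    have h1 : fieldCoord X φ p = tangentCoord φ (jetInv φ p) (X ⟨_, jetInv_mem_slit hk hφ hp⟩) :=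
      dif_pos (jetInv_mem_slit hk hφ hp)
    rw [h1, hX' φ hφ ⟨_, jetInv_mem_slit hk hφ hp⟩ (proj_jetInv_mem hφ hp.1),
      jetCoord_jetInv hφ hp.1]
  have hk0 : ((k : ℝ) + 1) ≠ 0 := by positivity
  refine ⟨⟨X, fun φ hφ => (contDiffOn_semisprayField (hG φ hφ)).congr (hfield φ hφ),
    fun φ hφ u hu => ?_⟩, fun φ hφ i p hp => ?_⟩
  · rw [tangentStructure_eq_liouville_iff, hX' φ hφ u hu]
    conv_lhs => rw [semisprayField_eq]
    rw [semisprayField_eq, semisprayField_last]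
    congr 3
    funext j
    field_simp
  · unfold KSemispray.coeff
    simp only
    rw [hfield φ hφ p hp, semisprayField_last]
    simp only
    field_simp

lemma exists_isMironConnection (hk : 1 ≤ k) (S : KSemispray n k M) :
    ∃ N : NonlinearConnection n k M, IsMironConnection S N :=
  exists_nonlinearConnection (fun φ => mironCoeff (S.coeff φ))
    (fun φ hφ => contDiffOn_mironCoeff (isOpen_slitCoord φ) (S.contDiffOn_coeff hφ))
    fun φ hφ ψ hψ _ hp => dualLaw_mironCoeff hk (isOpen_overlap φ ψ) (isOpen_slitCoord ψ)
      (fun _ hq => contDiffAt_trans_of_mem_overlap hφ hψ hq)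
      (fun _ hq => jetMap_mem_slitCoord hk hφ hψ hq)
      (fun i => (S.contDiffOn_coeff hφ i).mono (overlap_subset φ ψ)) (S.contDiffOn_coeff hψ)
      (fun _ hq i => S.coeff_jetMap hk hφ hψ hq i) hp

lemma exists_isBucataruConnection (hk : 1 ≤ k) (S : KSemispray n k M) :
    ∃ N : NonlinearConnection n k M, IsBucataruConnection S N :=
  exists_nonlinearConnection (fun φ => bucataruCoeff (S.coeff φ))
    (fun φ hφ => contDiffOn_bucataruCoeff (isOpen_slitCoord φ) (S.contDiffOn_coeff hφ))
    fun φ hφ ψ hψ p hp => dualLaw_bucataruCoeff (contDiffAt_trans_of_mem_overlap hφ hψ hp)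
      (fun i => ((S.contDiffOn_coeff hφ i).contDiffAt ((isOpen_slitCoord φ).mem_nhds
        (overlap_subset φ ψ hp))).differentiableAt (by simp))
      (fun i => ((S.contDiffOn_coeff hψ i).contDiffAt ((isOpen_slitCoord ψ).mem_nhds
        (jetMap_mem_slitCoord hk hφ hψ hp))).differentiableAt (by simp))
      (((isOpen_overlap φ ψ).eventually_mem hp).mono
        fun _ hq i => S.coeff_jetMap hk hφ hψ hq i)

/-- The `k`-sprays are the fixed points of the passage to the next `k`-semispray. -/
lemma KSemispray.IsSpray.isNextSemispray_self {S : KSemispray n k M} (hS : S.IsSpray) :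
    IsNextSemispray S S := by
  intro φ hφ i p hp
  have hd := ((S.contDiffOn_coeff hφ i).contDiffAt
    ((isOpen_slitCoord φ).mem_nhds hp)).differentiableAt (by simp)
  have hk : ((k : ℝ) + 1) ≠ 0 := by positivity
  rw [derivAlong_liouville hd (hS φ hφ i p hp)]
  push_cast
  field_simp

lemma IsNextSemispray.unique {S S₁ S₂ : KSemispray n k M} (h₁ : IsNextSemispray S S₁)
    (h₂ : IsNextSemispray S S₂) : S₁ = S₂ :=
  KSemispray.ext_coeff fun φ hφ i p hp => (h₁ φ hφ i p hp).trans (h₂ φ hφ i p hp).symm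

/-! ### Finsler spaces: the canonical semispray and the Cartan connection. -/

variable {F : AccBundle n k M → ℝ}

lemma IsFinslerSpace.contDiffOn_localSq (hF : IsFinslerSpace F) (hk : 1 ≤ k)
    (hφ : φ ∈ LocalCharts n M) : ContDiffOn ℝ ∞ (localSq F φ) (slitCoord k φ) := by
  have h1 : ContMDiffOn 𝓘(ℝ, JetModel n k) 𝓘(ℝ, JetModel n k) ∞ (jetInv φ) (slitCoord k φ) :=
    (contMDiffOn_symm_of_mem_maximalAtlas (I := 𝓘(ℝ, JetModel n k))
      (IsManifold.subset_maximalAtlas (jetChart_mem_atlas (k := k) hφ))).mono fun p hp => hp.1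
  exact (hF.smooth.comp h1 fun p hp => jetInv_mem_slit hk hφ hp).contDiffOn.pow 2

lemma IsFinslerSpace.localSq_dilation (hF : IsFinslerSpace F) (hφ : φ ∈ LocalCharts n M) {c : ℝ}
    (hc : 0 < c) {p : JetModel n k} (hp : p ∈ slitCoord k φ) :
    localSq F φ (dilation c p) = c ^ (2 * k) * localSq F φ p := by
  unfold localSq
  rw [hF.homogeneous φ hφ p hp.1 c hc]
  ring

lemma IsFinslerSpace.contDiffOn_canonicalCoeff (hF : IsFinslerSpace F) (hk : 1 ≤ k)
    (hφ : φ ∈ LocalCharts n M) (i : Fin n) :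
    ContDiffOn ℝ ∞ (canonicalCoeff (localSq F φ) i) (slitCoord k φ) :=
  HigherTangent.contDiffOn_canonicalCoeff (isOpen_slitCoord φ) (hF.contDiffOn_localSq hk hφ)
    (hF.posDef φ hφ) i

lemma IsFinslerSpace.existsUnique_isCanonicalSemispray (hF : IsFinslerSpace F) (hk : 1 ≤ k) :
    ∃! S : KSemispray n k M, IsCanonicalSemispray F S := by
  obtain ⟨S, hS⟩ := exists_kSemispray hk (fun φ => canonicalCoeff (localSq F φ))
    (fun φ hφ => hF.contDiffOn_canonicalCoeff hk hφ)
    fun φ hφ ψ hψ p hp => fderiv_jetMap_canonical hk (isOpen_overlap φ ψ) (isOpen_slitCoord ψ)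
      (fun _ hq => contDiffAt_trans_of_mem_overlap hφ hψ hq)
      (fun _ hq => jetMap_mem_slitCoord hk hφ hψ hq) (hF.contDiffOn_localSq hk hψ)
      (fun q hq => by simp only [localSq, jetInv_jetMap hφ hψ hq]) hp
      (hF.posDef φ hφ p (overlap_subset φ ψ hp))
      (hF.posDef ψ hψ _ (jetMap_mem_slitCoord hk hφ hψ hp))
      (isUnit_coordMat_zero hφ hψ hp.1.1 hp.1.2)
  exact ⟨S, hS, fun S' hS' => KSemispray.ext_coeff fun φ hφ i p hp =>
    (hS' φ hφ i p hp).trans (hS φ hφ i p hp).symm⟩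

lemma IsCanonicalSemispray.isSpray {S : KSemispray n k M} (hS : IsCanonicalSemispray F S)
    (hF : IsFinslerSpace F) (hk : 1 ≤ k) : S.IsSpray := by
  intro φ hφ i p hp c hc
  rw [hS φ hφ i p hp, hS φ hφ i _ (dilation_mem_slitCoord hc hp)]
  exact canonicalCoeff_dilation hk (isOpen_slitCoord φ) hc
    (fun q hq => dilation_mem_slitCoord hc hq) (hF.contDiffOn_localSq hk hφ)
    (fun q hq => hF.localSq_dilation hφ hc hq) hp i

/-- The coefficients of `S` equal the canonical ones on an open set, hence so do the Miron
coefficients derived from them, which are Cartan's. -/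
lemma IsMironConnection.isCartanConnection {S : KSemispray n k M} {N : NonlinearConnection n k M}
    (hN : IsMironConnection S N) (hS : IsCanonicalSemispray F S) (hF : IsFinslerSpace F)
    (hk : 1 ≤ k) : IsCartanConnection F N := by
  intro φ hφ
  have hU := isOpen_slitCoord (k := k) φ
  refine (hN φ hφ).congr hφ fun a i j p hp => ?_
  rw [cartanCoeff_eqOn hU (hF.contDiffOn_localSq hk hφ) (hF.posDef φ hφ) a i j hp]
  exact dualRecursion_congr hU (hS φ hφ) (fun i j => pderivY_congr hU (hS φ hφ i) k j) a i j hp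

lemma IsBucataruConnection.isBucataruConnectionOfSq {S : KSemispray n k M}
    {N : NonlinearConnection n k M} (hN : IsBucataruConnection S N)
    (hS : IsCanonicalSemispray F S) : IsBucataruConnectionOfSq F N := fun φ hφ =>
  (hN φ hφ).congr hφ fun _ i j => pderivY_congr (isOpen_slitCoord φ) (hS φ hφ i) _ j

end Objects

end HigherTangent

end

/-! ### The theorem. -/

theorem mainTheorem5 (n k : ℕ) (hk : 1 ≤ k) (M : Type*) [TopologicalSpace M]
    [ChartedSpace (EuclideanSpace ℝ (Fin n)) M] [IsManifold (𝓡 n) ∞ M]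
    (F : HigherTangent.AccBundle n k M → ℝ) (hF : HigherTangent.IsFinslerSpace F) :
    (∃! S₁ : HigherTangent.KSemispray n k M, HigherTangent.IsCanonicalSemispray F S₁) ∧
    ∀ S₁ : HigherTangent.KSemispray n k M, HigherTangent.IsCanonicalSemispray F S₁ →
      S₁.IsSpray ∧
      (∃ (S : ℕ+ → HigherTangent.KSemispray n k M)
        (N Nstar : ℕ+ → HigherTangent.NonlinearConnection n k M),
          HigherTangent.IsSequenceFrom S₁ S N Nstar) ∧
      ∀ (S : ℕ+ → HigherTangent.KSemispray n k M)
        (N Nstar : ℕ+ → HigherTangent.NonlinearConnection n k M),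
          HigherTangent.IsSequenceFrom S₁ S N Nstar →
            (∀ m, S m = S₁) ∧
            (∀ m, N m = N 1) ∧ (∀ m, Nstar m = Nstar 1) ∧
            HigherTangent.IsCartanConnection F (N 1) ∧
            HigherTangent.IsBucataruConnectionOfSq F (Nstar 1) := by
  refine ⟨hF.existsUnique_isCanonicalSemispray hk, fun S₁ hS₁ => ?_⟩
  have hspray := hS₁.isSpray hF hk
  refine ⟨hspray, ?_, fun S N Nstar h => ?_⟩
  · obtain ⟨N, hN⟩ := HigherTangent.exists_isMironConnection hk S₁
    obtain ⟨Nstar, hNstar⟩ := HigherTangent.exists_isBucataruConnection hk S₁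
    -- Constant sequences serve, because a spray is its own successor.
    exact ⟨fun _ => S₁, fun _ => N, fun _ => Nstar, rfl, fun _ => hspray.isNextSemispray_self,
      fun _ => hN, fun _ => hNstar⟩
  -- The successor is unique, so any sequence that starts at the spray `S₁` stays there.
  · have hS : ∀ m, S m = S₁ := fun m => by
      induction m using PNat.recOn with
      | one => exact h.start
      | succ m ih =>
        have hm := h.next m
        rw [ih] at hm
        exact hm.unique hspray.isNextSemispray_self
    have hN : ∀ m, HigherTangent.IsMironConnection S₁ (N m) := fun m => hS m ▸ h.miron m
    have hNstar : ∀ m, HigherTangent.IsBucataruConnection S₁ (Nstar m) := fun m =>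
      hS m ▸ h.bucataru m
    exact ⟨hS, fun m => HigherTangent.NonlinearConnection.eq_of_hasDualCoeff (hN m) (hN 1),
      fun m => HigherTangent.NonlinearConnection.eq_of_hasDualCoeff (hNstar m) (hNstar 1),
      (hN 1).isCartanConnection hS₁ hF hk, (hNstar 1).isBucataruConnectionOfSq hS₁⟩
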